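/- **Setting.** Let $\xi\in C^3(\mathbb R^3;\mathbb R)$ be such that $\Omega=\{\xi<0\}$ is bounded, $\partial\Omega=\{\xi=0\}$, $\zeta\cdot\nabla^2\xi(x)\zeta\ge c_\xi|\zeta|^2$ for all $x\in\bar\Omega$, $\zeta\in\mathbb R^3$ and some $c_\xi>0$, and $\nabla\xi\neq0$ wherever $|\xi|$ is small enough on $\bar\Omega$. Put $n=\nabla\xi/|\nabla\xi|$ on $\partial\Omega$. For $x\in\Omega$ close to $\partial\Omega$ let $\bar x\in\partial\Omega$ be the nearest boundary point. Let $T>0$. A field $E:[0,T]\times\bar\Omega\to\mathbb R^3$ is continuous, is differentiable in $x\in\Omega$ and in $t\in(0,T)$ with $\|E\|_\infty+\|\nabla_xE\|_\infty+\|\partial_tE\|_\infty<\infty$ (norms over $[0,T]\times\Omega$, respectively $(0,T)\times\Omega$ for $\partial_tE$), and satisfies the sign condition $E(t,x)\cdot n(x)>C_E>0$ for all $t\in[0,T]$, $x\in\partial\Omega$. **Kinetic distance.** For a small $r>0$ let $\Omega^r=\{x\in\Omega: d(x,\partial\Omega)<r\}$ and $\epsilon=\min\{|\xi(x)|:x\in\Omega,\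 d(x,\partial\Omega)=r\}$. Let $\chi:[0,\infty)\to[0,\infty)$ be smooth with $\chi(y)=y$ on $[0,\epsilon/4]$, $\chi$ increasing on $(\epsilon/4,\epsilon/2)$, $\chi\equiv c$ constant on $[\epsilon/2,\infty)$, and $\chi'\le1$. Define $\alpha(t,x,v)=c$ for $x\in\Omega\setminus\Omega^r$ and, for $x\in\Omega^r$, $$\alpha(t,x,v)=\chi\Big(\big[\,|v\cdot\nabla\xi(x)|^2+\xi(x)^2-2(v\cdot\nabla^2\xi(x)v)\,\xi(x)-2(E(t,\bar x)\cdot\nabla\xi(\bar x))\,\xi(x)\big]^{1/2}\Big).$$ **Characteristics.** For $(t,x,v)\in[0,T]\times\Omega\times\mathbb R^3$ let $(X(s),V(s))$ solve $X'=V$, $V'=E(s,X)$, $X(t)=x$, $V(t)=v$, let $t_{\mathbf b}=\sup\{s\ge0: X(\tau)\in\Omega\ \text{for all }\tau\in(t-s,t)\}$, and write $\langle v\rangle=(1+|v|^2)^{1/2}$. **Lemma (non-local to local estimate).** There are $C_\xi>0$ and $r_0>0$ depending only on $\xi$ such that the following holds for every $0<r<r_0$ and every cutoff $\chi$ as above.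 Let $T>0$, $1<\beta<3$, $0<\kappa\le1$, $C_\theta>0$. There is a constant $C>0$ depending only on $\xi,r,\chi,T,\beta,\kappa,C_\theta$ such that for all $C_E>0$ and $M$ there are $\varpi_0>0$ and $\delta_0>0$ (which may depend on all of these parameters) with the following property. For every field $E$ as above with $\|E\|_\infty+\|\nabla_xE\|_\infty+\|\partial_tE\|_\infty\le M$ and with $E\cdot n>C_E$ on $[0,T]\times\partial\Omega$, all $\varpi\ge\varpi_0$, all $0<\delta<\delta_0$ and all $(t,x,v)\in[0,T]\times\Omega\times\mathbb R^3$, $$\begin{aligned}&\int_{\max\{0,t-t_{\mathbf b}\}}^t\int_{\mathbb R^3}e^{-\int_s^t\frac{\varpi}{2}\langle V(\tau)\rangle d\tau}\,\frac{e^{-\frac{C_\theta}{2}|V(s)-u|^2}}{|V(s)-u|^{2-\kappa}}\,\frac{1}{\alpha(s,X(s),u)^\beta}\,du\,ds\\ &\le C\Bigg[e^{2C_\xi\frac{\|\nabla_x E\|_\infty+\|E\|_\infty^2+\|E\|_\infty}{C_E}}\frac{\delta^{\frac{3-\beta}{2}}}{C_E^{\frac{\beta-1}{2}}\,\alpha(t,x,v)^{\beta-2}\,(|v|^2+\|E\|_\infty^2+\|E\|_\infty+1)^{\frac{3-\beta}{2}}}\\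 &\qquad+\frac{(|v|+\|E\|_\infty+\|E\|_\infty^2+1)^{\beta-1}}{C_E^{\beta-1}\,\delta^{\beta-1}\,\alpha(t,x,v)^{\beta-1}}\,\frac{2}{\varpi}\Bigg].\end{aligned}$$ -/

import Mathlib

open Set MeasureTheory
open scoped ENNReal ContDiff

noncomputable section

namespace KineticDomain

/-- Physical and velocity space `ℝ³` with the Euclidean norm. -/
abbrev R3 : Type := EuclideanSpace ℝ (Fin 3)

/-- The domain `Ω = {ξ < 0}`. -/
def dom (ξ : R3 → ℝ) : Set R3 := {x | ξ x < 0}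

/-- The quadratic form `ζ · ∇²ξ(x) · ζ`. -/
def hess (ξ : R3 → ℝ) (x ζ : R3) : ℝ := fderiv ℝ (fderiv ℝ ξ) x ζ ζ

/-- `Ω = {ξ < 0}` is bounded with `∂Ω = {ξ = 0}`, where `ξ` is of class `C³`, has a uniformly positive Hessian
on the closure of `Ω`, and has no critical point in `closure Ω` near the boundary. -/
structure IsStrictlyConvexDomain (ξ : R3 → ℝ) : Prop where
  contDiff : ContDiff ℝ 3 ξ
  bounded : Bornology.IsBounded (dom ξ)
  frontier_eq : frontier (dom ξ) = {x | ξ x = 0}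
  hess_pos : ∃ c : ℝ, 0 < c ∧ ∀ x ∈ closure (dom ξ), ∀ ζ : R3, c * ‖ζ‖ ^ 2 ≤ hess ξ x ζ
  gradient_ne : ∃ η : ℝ, 0 < η ∧ ∀ x ∈ closure (dom ξ), |ξ x| < η → gradient ξ x ≠ 0

/-- The outward unit normal `n(x) = ∇ξ(x) / |∇ξ(x)|`, for `x ∈ ∂Ω`. -/
def normal (ξ : R3 → ℝ) (x : R3) : R3 := (‖gradient ξ x‖)⁻¹ • gradient ξ x

/-- `‖E‖_∞` on `[0,T] × Ω`, as an extended nonnegative number. -/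
def supNorm (ξ : R3 → ℝ) (T : ℝ) (E : ℝ → R3 → R3) : ℝ≥0∞ :=
  ⨆ t ∈ Icc 0 T, ⨆ x ∈ dom ξ, ‖E t x‖ₑ

/-- `‖∇ₓE‖_∞` on `[0,T] × Ω`. -/
def gradNorm (ξ : R3 → ℝ) (T : ℝ) (E : ℝ → R3 → R3) : ℝ≥0∞ :=
  ⨆ t ∈ Icc 0 T, ⨆ x ∈ dom ξ, ‖fderiv ℝ (E t) x‖ₑ

/-- `‖∂ₜE‖_∞` on `(0,T) × Ω`. -/
def timeNorm (ξ : R3 → ℝ) (T : ℝ) (E : ℝ → R3 → R3) : ℝ≥0∞ :=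
  ⨆ t ∈ Ioo 0 T, ⨆ x ∈ dom ξ, ‖deriv (fun s => E s x) t‖ₑ

/-- A field on `[0,T]` whose sup norm and first derivatives are bounded, with total bound `M`,
and which satisfies the sign condition `E · n > C_E` on `∂Ω`. Nothing is required of `E` outside
`[0,T] × closure Ω`. -/
structure IsAdmissibleField (ξ : R3 → ℝ) (T CE M : ℝ) (E : ℝ → R3 → R3) : Prop where
  continuousOn : ContinuousOn (fun p : ℝ × R3 => E p.1 p.2) (Icc 0 T ×ˢ closure (dom ξ))
  differentiable_x : ∀ t ∈ Icc 0 T, DifferentiableOn ℝ (E t) (dom ξ)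
  differentiable_t : ∀ x ∈ dom ξ, DifferentiableOn ℝ (fun t => E t x) (Ioo 0 T)
  bound : supNorm ξ T E + gradNorm ξ T E + timeNorm ξ T E ≤ ENNReal.ofReal M
  sign : ∀ t ∈ Icc 0 T, ∀ x ∈ frontier (dom ξ), CE < inner ℝ (E t x) (normal ξ x)

/-- The point `x̄ ∈ ∂Ω` nearest to `x` (unique when `x` is close enough to `∂Ω`). -/
def nearest (ξ : R3 → ℝ) (x : R3) : R3 :=
  Classical.epsilon fun y => y ∈ frontier (dom ξ) ∧ dist x y = Metric.infDist x (frontier (dom ξ))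

/-- The collar `Ω^r` of points of `Ω` at distance less than `r` from `∂Ω`. -/
def collar (ξ : R3 → ℝ) (r : ℝ) : Set R3 :=
  {x | x ∈ dom ξ ∧ Metric.infDist x (frontier (dom ξ)) < r}

/-- `min {|ξ(x)| : x ∈ Ω, d(x,∂Ω) = r}`. -/
def collarDepth (ξ : R3 → ℝ) (r : ℝ) : ℝ :=
  sInf ((fun x => |ξ x|) '' {x | x ∈ dom ξ ∧ Metric.infDist x (frontier (dom ξ)) = r})

/-- A smooth cutoff `χ_ε : [0,∞) → [0,∞)`: the identity on `[0,ε/4]`, increasing on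
`(ε/4,ε/2)`, equal to the constant `c = C_ε` on `[ε/2,∞)`, and of slope at most one. -/
structure IsCutoff (ε c : ℝ) (χ : ℝ → ℝ) : Prop where
  smooth : ContDiffOn ℝ ∞ χ (Ici 0)
  nonneg : ∀ y, 0 ≤ y → 0 ≤ χ y
  eq_id : ∀ y, 0 ≤ y → y ≤ ε / 4 → χ y = y
  eq_const : ∀ y, ε / 2 ≤ y → χ y = c
  mono : MonotoneOn χ (Ioo (ε / 4) (ε / 2))
  deriv_le : ∀ y, 0 < y → deriv χ y ≤ 1

/-- The untruncated distance to the grazing set,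
`[|v·∇ξ(x)|² + ξ(x)² - 2 (v·∇²ξ(x)·v) ξ(x) - 2 (E(t,x̄)·∇ξ(x̄)) ξ(x)]^{1/2}`. -/
def grazingDist (ξ : R3 → ℝ) (E : ℝ → R3 → R3) (t : ℝ) (x v : R3) : ℝ :=
  Real.sqrt ((inner ℝ v (gradient ξ x)) ^ 2 + ξ x ^ 2 - 2 * hess ξ x v * ξ x
    - 2 * inner ℝ (E t (nearest ξ x)) (gradient ξ (nearest ξ x)) * ξ x)

open Classical in
/-- The kinetic distance `α(t,x,v)`: the truncation of `grazingDist` by `χ` in the collar `Ω^r`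
and the constant `c` in the rest of the domain. -/
def alpha (ξ : R3 → ℝ) (r : ℝ) (χ : ℝ → ℝ) (c : ℝ) (E : ℝ → R3 → R3) (t : ℝ) (x v : R3) : ℝ :=
  if x ∈ collar ξ r then χ (grazingDist ξ E t x v) else c

/-- The backward exit time `t_b = sup {s ≥ 0 : X(τ) ∈ Ω for all τ ∈ (t-s,t)}` of a trajectory `X`,
possibly infinite. -/
def exitTime (ξ : R3 → ℝ) (X : ℝ → R3) (t : ℝ) : EReal :=
  sSup ((fun s : ℝ => (s : EReal)) '' {s | 0 ≤ s ∧ ∀ τ ∈ Ioo (t - s) t, X τ ∈ dom ξ})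

/-- The number `max {0, t - t_b}`. -/
def startTime (ξ : R3 → ℝ) (X : ℝ → R3) (t : ℝ) : ℝ :=
  (max 0 ((t : EReal) - exitTime ξ X t)).toReal

/-- `(X,V)` is the backward characteristic from `(t,x,v)`: it solves `X' = V`, `V' = E(s,X)` on
the interval `[max {0, t - t_b}, t]`, with `X(t) = x` and `V(t) = v`. Values of `X` and `V` at
times before the backward exit, or before time `0`, play no role. -/
structure IsBackwardCharacteristic (ξ : R3 → ℝ) (E : ℝ → R3 → R3) (t : ℝ) (x v : R3)
    (X V : ℝ → R3) : Prop where
  pos : X t = x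
  vel : V t = v
  deriv_pos : ∀ s ∈ Icc (startTime ξ X t) t,
    HasDerivWithinAt X (V s) (Icc (startTime ξ X t) t) s
  deriv_vel : ∀ s ∈ Icc (startTime ξ X t) t,
    HasDerivWithinAt V (E s (X s)) (Icc (startTime ξ X t) t) s

/-- `⟨v⟩ = (1 + |v|²)^{1/2}`. -/
def bracket (v : R3) : ℝ := Real.sqrt (1 + ‖v‖ ^ 2)

end KineticDomain

end

open KineticDomain

/-! The estimate separates into a velocity integral at fixed time and a time integral along one
trajectory.

Velocity. In the collar, convexity of `ξ` and the sign condition bound `α(s,x,u)²`, up to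
truncation, below by `(u·∇ξ)² + 2c₁ C_E |ξ(x)|`. Only the component of `u` along `∇ξ` sees this
weight. Splitting the kernel singularity between the two tangential components leaves an elementary
one-dimensional integral, and the result is at most a constant times `1 + (C_E
|ξ(X(s))|)^(-(β-1)/2)` (`exists_lintegral_kernel_le`, `exists_lintegral_velocity_le`).

Time. Put `f = ξ ∘ X`, so that `f'' = V·∇²ξ V + E·∇ξ`, and `W = |v|² + 1`. Since `V` varies by a
bounded amount, `f''` is at most of order `W`; near the boundary it is also at least of order `W`,
by the Hessian for large velocities and the sign condition for small ones. Hence `f'² + W|f|` at an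
earlier time controls `α(t,x,v)²`. If the depth is at most `θ`, with `Wθ` small against `α²`, the
whole bound falls on `f'`: there `|f'|` is at least of order `α`, and the depth grows linearly away
from one end of the trajectory (`exists_linear_growth`). Because `(β-1)/2 < 1`, the times of depth
at most `θ` contribute about `θ^((3-β)/2)/α`; the remaining times contribute `θ^(-(β-1)/2)` times
`2/ϖ` (`lintegral_exp_mul_rpow_le`).

Constants. With `θ = μδα²/W` the two contributions take the shape of the two terms of the claim. The
constants of the dynamics depend on `C_E` and `M`, which the final `C` may not. They are absorbed in
`μ`; the price for a small `μ` in the second term is paid by the spare power of `δ`, as the claim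
allows `δ^(-(β-1))` where only `δ^(-(β-1)/2)` is produced (`exists_threshold`). The exponential
factor serves only as a number at least one. -/

/-! ### The velocity integral against the singular kernel -/

lemma integrable_abs_rpow_mul_exp_neg_mul_sq {b s : ℝ} (hb : 0 < b) (hs : -1 < s) :
    Integrable fun x : ℝ => |x| ^ s * Real.exp (-b * x ^ 2) := by
  have h : IntegrableOn (fun x : ℝ => |x| ^ s * Real.exp (-b * x ^ 2)) (Ioi 0) := by
    refine (integrableOn_rpow_mul_exp_neg_mul_sq hb hs).congr_fun (fun x hx => ?_) measurableSet_Ioi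
    simp only [abs_of_pos (mem_Ioi.1 hx)]
  have h' : IntegrableOn (fun x : ℝ => |x| ^ s * Real.exp (-b * x ^ 2)) (Iio 0) := by
    have := h.comp_neg
    simpa using this
  have := h'.union ((integrableOn_Ici_iff_integrableOn_Ioi (by finiteness)).2 h)
  rwa [Iio_union_Ici, integrableOn_univ] at this

lemma integrable_one_add_sq_rpow {β : ℝ} (hβ : 1 < β) :
    Integrable fun x : ℝ => (1 + x ^ 2) ^ (-β / 2) := by
  have := integrable_rpow_neg_one_add_norm_sq (E := ℝ) (μ := volume) (r := β) (by simpa using hβ)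
  simpa using this

lemma scaled_sq_rpow_eq {m b : ℝ} (hb : 0 < b) (β w : ℝ) :
    (m ^ 2 * w ^ 2 + b) ^ (-β / 2) = b ^ (-β / 2) * (1 + (m / √b * w) ^ 2) ^ (-β / 2) := by
  rw [← Real.mul_rpow hb.le (by positivity)]
  congr 1
  rw [mul_pow, div_pow, Real.sq_sqrt hb.le]
  field_simp
  ring

lemma integrable_scaled_sq_rpow {β m b : ℝ} (hβ : 1 < β) (hm : 0 < m) (hb : 0 < b) :
    Integrable fun w : ℝ => (m ^ 2 * w ^ 2 + b) ^ (-β / 2) := by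
  simp_rw [scaled_sq_rpow_eq hb]
  exact ((integrable_one_add_sq_rpow hβ).comp_mul_left' (by positivity)).const_mul _

/-- Source of the exponent `(β-1)/2`: rescaling by `√b / m` turns `b^(-β/2)` into `b^(-β/2) √b`. -/
lemma integral_scaled_sq_rpow {β m b : ℝ} (hm : 0 < m) (hb : 0 < b) :
    ∫ w : ℝ, (m ^ 2 * w ^ 2 + b) ^ (-β / 2)
      = b ^ (-((β - 1) / 2)) * (m⁻¹ * ∫ w : ℝ, (1 + w ^ 2) ^ (-β / 2)) := by
  simp_rw [scaled_sq_rpow_eq hb]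
  rw [integral_const_mul, Measure.integral_comp_mul_left (fun w : ℝ => (1 + w ^ 2) ^ (-β / 2)),
    abs_of_pos (by positivity), smul_eq_mul, inv_div, Real.sqrt_eq_rpow, div_eq_mul_inv]
  have : b ^ (-((β - 1) / 2)) = b ^ (-β / 2) * b ^ ((1 : ℝ) / 2) := by
    rw [← Real.rpow_add hb]; congr 1; ring
  rw [this, show (1 : ℝ) / 2 = 2⁻¹ by norm_num]; ring_nf

/-- The two-dimensional singularity is dominated by a product of one-dimensional ones. -/
lemma rpow_neg_sum_sq_le {p a b c : ℝ} (hp : 0 ≤ p) (ha : a ≠ 0) (hb : b ≠ 0) :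
    (√(c ^ 2 + a ^ 2 + b ^ 2) ^ p)⁻¹ ≤ |a| ^ (-(p / 2)) * |b| ^ (-(p / 2)) := by
  have ha' := abs_pos.2 ha
  have hb' := abs_pos.2 hb
  rw [← Real.mul_rpow ha'.le hb'.le, Real.rpow_neg (by positivity)]
  have h : |a| * |b| ≤ c ^ 2 + a ^ 2 + b ^ 2 := by
    rw [← sq_abs a, ← sq_abs b]
    nlinarith [sq_nonneg (|a| - |b|), sq_nonneg c]
  rw [Real.sqrt_eq_rpow, ← Real.rpow_mul (by positivity)]
  apply inv_anti₀ (by positivity)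
  rw [show 1 / 2 * p = p / 2 by ring]
  exact Real.rpow_le_rpow (by positivity) h (by positivity)

/-- Rotated coordinates in which a weight in `u·G` depends on the first coordinate alone, so that
Tonelli applies. -/
lemma exists_orthonormalBasis_inner_eq {G : R3} (hG : G ≠ 0) :
    ∃ B : OrthonormalBasis (Fin 3) ℝ R3, ∀ u : R3, inner ℝ u G = ‖G‖ * B.repr u 0 := by
  have hv : Orthonormal ℝ (({0} : Set (Fin 3)).domRestrict fun _ : Fin 3 => (‖G‖⁻¹ • G : R3)) := by
    constructor
    · intro i
      change ‖(‖G‖⁻¹ • G : R3)‖ = 1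
      rw [norm_smul, norm_inv, norm_norm, inv_mul_cancel₀ (norm_ne_zero_iff.2 hG)]
    · intro i j hij
      exact absurd (Subsingleton.elim i j) hij
  obtain ⟨B, hB⟩ := hv.exists_orthonormalBasis_extension_of_card_eq (by simp)
  refine ⟨B, fun u => ?_⟩
  rw [B.repr_apply_apply, hB 0 rfl, real_inner_smul_left, real_inner_comm,
    mul_inv_cancel_left₀ (norm_ne_zero_iff.2 hG)]

/-- The velocity integral against a kernel with a weak singularity, for a weight which depends on
one component only and degenerates as `b → 0`. -/
lemma exists_lintegral_kernel_le {β κ Cθ A m : ℝ} (hβ : 1 < β) (hκ : 0 < κ) (hκ' : κ ≤ 1)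
    (hC : 0 < Cθ) (hA : 0 ≤ A) (hm : 0 < m) :
    ∃ C : ℝ, 0 < C ∧ ∀ (V G : R3) (b : ℝ), m ≤ ‖G‖ → 0 < b →
      ∫⁻ u : R3, ENNReal.ofReal (Real.exp (-(Cθ / 2) * ‖V - u‖ ^ 2) / ‖V - u‖ ^ (2 - κ)
        * (A + (inner ℝ u G ^ 2 + b) ^ (-β / 2)))
      ≤ ENNReal.ofReal (C * (1 + b ^ (-((β - 1) / 2)))) := by
  set k : ℝ → ℝ := fun y => |y| ^ (-((2 - κ) / 2)) * Real.exp (-(Cθ / 2) * y ^ 2) with hk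
  have hkint : Integrable k :=
    integrable_abs_rpow_mul_exp_neg_mul_sq (by positivity) (by linarith)
  set g : ℝ → ℝ := fun y => Real.exp (-(Cθ / 2) * y ^ 2) with hg
  have hgint : Integrable g := integrable_exp_neg_mul_sq (by positivity)
  have hk0 : 0 ≤ ∫ y, k y := integral_nonneg fun y => by positivity
  have hg0 : 0 ≤ ∫ y, g y := integral_nonneg fun y => by positivity
  have hJ0 : 0 ≤ ∫ w : ℝ, (1 + w ^ 2) ^ (-β / 2) := integral_nonneg fun y => by positivity
  set J := ∫ w : ℝ, (1 + w ^ 2) ^ (-β / 2)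
  refine ⟨(A * (∫ y, g y) + m⁻¹ * J) * ((∫ y, k y) * ∫ y, k y) + 1, by positivity, ?_⟩
  intro V G b hG hb
  obtain ⟨B, hB⟩ := exists_orthonormalBasis_inner_eq (norm_pos_iff.1 (hm.trans_le hG))
  set z := B.repr V
  -- One factor per coordinate. The Gaussian in the first coordinate is kept beside `A`, for
  -- integrability, and bounded by one beside the weight, which is integrable since `β > 1`.
  set φ : Fin 3 → ℝ → ℝ := ![fun w => A * g (w - z 0) + (m ^ 2 * w ^ 2 + b) ^ (-β / 2),
    fun w => k (w - z 1), fun w => k (w - z 2)] with hφ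
  have hφ0 : Integrable (φ 0) :=
    ((hgint.comp_sub_right (z 0)).const_mul A).add (integrable_scaled_sq_rpow hβ hm hb)
  have hφint : ∀ i, Integrable (φ i) := by
    intro i
    fin_cases i
    · exact hφ0
    · exact hkint.comp_sub_right (z 1)
    · exact hkint.comp_sub_right (z 2)
  have hφnn : ∀ i y, 0 ≤ φ i y := by
    intro i y
    fin_cases i
    · simp [hφ, hg]; positivity
    · simp [hφ, hk]; positivity
    · simp [hφ, hk]; positivity
  have hint0 : ∫ w, φ 0 w = A * (∫ y, g y) + b ^ (-((β - 1) / 2)) * (m⁻¹ * J) := by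
    rw [← integral_scaled_sq_rpow hm hb, ← integral_sub_right_eq_self g (z 0),
      ← integral_const_mul]
    exact integral_add ((hgint.comp_sub_right (z 0)).const_mul A)
      (integrable_scaled_sq_rpow hβ hm hb)
  have hprod : ∫ w : Fin 3 → ℝ, ∏ i, φ i (w i)
      = (A * (∫ y, g y) + b ^ (-((β - 1) / 2)) * (m⁻¹ * J)) * ((∫ y, k y) * ∫ y, k y) := by
    rw [integral_fin_nat_prod_volume_eq_prod, Fin.prod_univ_three, hint0]
    have h1 : ∫ w, φ 1 w = ∫ y, k y := integral_sub_right_eq_self k (z 1)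
    have h2 : ∫ w, φ 2 w = ∫ y, k y := integral_sub_right_eq_self k (z 2)
    rw [h1, h2]; ring
  have hmp : MeasurePreserving (fun w : Fin 3 → ℝ => B.repr.symm (WithLp.toLp 2 w)) :=
    B.measurePreserving_repr_symm.comp (PiLp.volume_preserving_toLp (Fin 3))
  have hemb : MeasurableEmbedding (fun w : Fin 3 → ℝ => B.repr.symm (WithLp.toLp 2 w)) :=
    B.measurableEquiv.symm.measurableEmbedding.comp
      (MeasurableEquiv.toLp 2 (Fin 3 → ℝ)).measurableEmbedding
  rw [← hmp.lintegral_comp_emb hemb]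
  calc _ ≤ ∫⁻ w : Fin 3 → ℝ, ENNReal.ofReal (∏ i, φ i (w i)) := by
        apply lintegral_mono_ae
        -- The null sets `w 1 = z 1` and `w 2 = z 2` must be removed: there the product majorant is
        -- zero, a negative power of zero being `0`.
        filter_upwards [Measure.ae_eval_ne (μ := fun _ : Fin 3 => (volume : Measure ℝ)) 1 (z 1),
          Measure.ae_eval_ne (μ := fun _ : Fin 3 => (volume : Measure ℝ)) 2 (z 2)] with w h1 h2
        apply ENNReal.ofReal_le_ofReal
        have hn : ‖V - B.repr.symm (WithLp.toLp 2 w)‖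
            = √((w 0 - z 0) ^ 2 + (w 1 - z 1) ^ 2 + (w 2 - z 2) ^ 2) := by
          rw [← B.repr.norm_map, map_sub, LinearIsometryEquiv.apply_symm_apply,
            EuclideanSpace.norm_eq, Fin.sum_univ_three]
          simp only [PiLp.sub_apply, Real.norm_eq_abs, sq_abs]
          change √((z 0 - w 0) ^ 2 + (z 1 - w 1) ^ 2 + (z 2 - w 2) ^ 2) = _
          congr 1
          ring
        have hsq : ‖V - B.repr.symm (WithLp.toLp 2 w)‖ ^ 2
            = (w 0 - z 0) ^ 2 + (w 1 - z 1) ^ 2 + (w 2 - z 2) ^ 2 := by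
          rw [hn, Real.sq_sqrt (by positivity)]
        rw [hsq, hB, LinearIsometryEquiv.apply_symm_apply, Fin.prod_univ_three, hn]
        have hs := rpow_neg_sum_sq_le (p := 2 - κ) (c := w 0 - z 0) (by linarith)
          (sub_ne_zero.2 h1) (sub_ne_zero.2 h2)
        have hexp : Real.exp (-(Cθ / 2) * ((w 0 - z 0) ^ 2 + (w 1 - z 1) ^ 2 + (w 2 - z 2) ^ 2))
            = g (w 0 - z 0) * (g (w 1 - z 1) * g (w 2 - z 2)) := by
          simp only [hg, ← Real.exp_add]; ring_nf
        have hg1 : g (w 0 - z 0) ≤ 1 := by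
          simp only [hg]
          apply Real.exp_le_one_iff.2
          have := mul_nonneg hC.le (sq_nonneg (w 0 - z 0))
          linarith
        have hpow : ((‖G‖ * w 0) ^ 2 + b) ^ (-β / 2) ≤ (m ^ 2 * w 0 ^ 2 + b) ^ (-β / 2) := by
          apply Real.rpow_le_rpow_of_nonpos (by positivity) _ (by linarith)
          rw [mul_pow]
          gcongr
        have hgn : ∀ y, 0 ≤ g y := fun y => (Real.exp_pos _).le
        rw [hexp, div_eq_mul_inv]
        simp only [hφ, Matrix.cons_val_zero, Matrix.cons_val_one, Matrix.cons_val]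
        have hlast : g (w 0 - z 0) * (A + ((‖G‖ * w 0) ^ 2 + b) ^ (-β / 2))
            ≤ A * g (w 0 - z 0) + (m ^ 2 * w 0 ^ 2 + b) ^ (-β / 2) := by
          have : g (w 0 - z 0) * ((‖G‖ * w 0) ^ 2 + b) ^ (-β / 2)
              ≤ 1 * (m ^ 2 * w 0 ^ 2 + b) ^ (-β / 2) := by gcongr
          linarith
        calc _ = (g (w 0 - z 0) * (A + ((‖G‖ * w 0) ^ 2 + b) ^ (-β / 2)))
              * (g (w 1 - z 1) * g (w 2 - z 2))
              * (√((w 0 - z 0) ^ 2 + (w 1 - z 1) ^ 2 + (w 2 - z 2) ^ 2) ^ (2 - κ))⁻¹ := by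
                ring
          _ ≤ (A * g (w 0 - z 0) + (m ^ 2 * w 0 ^ 2 + b) ^ (-β / 2))
              * (g (w 1 - z 1) * g (w 2 - z 2))
              * (|w 1 - z 1| ^ (-((2 - κ) / 2)) * |w 2 - z 2| ^ (-((2 - κ) / 2))) := by
                have := hgn (w 0 - z 0)
                have := hgn (w 1 - z 1)
                have := hgn (w 2 - z 2)
                gcongr
          _ = _ := by simp only [hk, hg]; ring
    _ = ENNReal.ofReal (∫ w : Fin 3 → ℝ, ∏ i, φ i (w i)) := by
        exact (ofReal_integral_eq_lintegral_ofReal (Integrable.fintype_prod hφint)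
          (ae_of_all _ fun w => Finset.prod_nonneg fun i _ => hφnn i _)).symm
    _ ≤ _ := by
        rw [hprod]
        apply ENNReal.ofReal_le_ofReal
        have hbp : 0 ≤ b ^ (-((β - 1) / 2)) := by positivity
        set q := b ^ (-((β - 1) / 2))
        set K := (∫ y, k y) * ∫ y, k y
        have hK : 0 ≤ K := by positivity
        have e1 : 0 ≤ A * (∫ y, g y) * K := by positivity
        have e2 : 0 ≤ m⁻¹ * J * K := by positivity
        nlinarith [mul_nonneg e1 hbp]

/-! ### One-dimensional dynamics of the depth -/

lemma second_order_lower_bound {f f₁ f₂ : ℝ → ℝ} {s r l : ℝ} (hsr : s ≤ r)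
    (hf : ∀ τ ∈ Icc s r, HasDerivWithinAt f (f₁ τ) (Icc s r) τ)
    (hf₁ : ∀ τ ∈ Icc s r, HasDerivWithinAt f₁ (f₂ τ) (Icc s r) τ)
    (hl : ∀ τ ∈ Ioo s r, l ≤ f₂ τ) :
    f₁ s + l * (r - s) ≤ f₁ r ∧ f s + f₁ s * (r - s) + l / 2 * (r - s) ^ 2 ≤ f r := by
  have h1 : ∀ τ ∈ Icc s r, f₁ s + l * (τ - s) ≤ f₁ τ := by
    have hm : MonotoneOn (fun τ => f₁ τ - l * τ) (Icc s r) := by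
      refine monotoneOn_of_hasDerivWithinAt_nonneg (f' := fun τ => f₂ τ - l * 1) (convex_Icc s r)
        (fun τ hτ => ((hf₁ τ hτ).continuousWithinAt.sub (by fun_prop))) (fun τ hτ => ?_)
        (fun τ hτ => ?_)
      · exact ((hf₁ τ (interior_subset hτ)).sub ((hasDerivWithinAt_id τ _).const_mul l)).mono
          interior_subset
      · rw [interior_Icc] at hτ
        linarith [hl τ hτ]
    intro τ hτ
    have := hm (left_mem_Icc.2 hsr) hτ hτ.1
    simp only at this
    linarith
  have hm : MonotoneOn (fun τ => f τ - f₁ s * (τ - s) - l / 2 * (τ - s) ^ 2) (Icc s r) := by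
    refine monotoneOn_of_hasDerivWithinAt_nonneg
      (f' := fun τ => f₁ τ - f₁ s * 1 - l / 2 * (((2 : ℕ) : ℝ) * (τ - s) ^ (2 - 1) * 1))
      (convex_Icc s r)
      (fun τ hτ => (((hf τ hτ).continuousWithinAt.sub (by fun_prop)).sub (by fun_prop)))
      (fun τ hτ => ?_) (fun τ hτ => ?_)
    · have hd : HasDerivWithinAt (fun τ => τ - s) 1 (Icc s r) τ :=
        (hasDerivWithinAt_id τ _).sub_const s
      exact (((hf τ (interior_subset hτ)).sub (hd.const_mul (f₁ s))).sub
        ((hd.pow 2).const_mul (l / 2))).mono interior_subset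
    · have := h1 τ (interior_subset hτ)
      norm_num
      linarith
  refine ⟨h1 r (right_mem_Icc.2 hsr), ?_⟩
  have := hm (left_mem_Icc.2 hsr) (right_mem_Icc.2 hsr) hsr
  simp only [sub_self] at this
  nlinarith

/-- For a nonpositive function with pinched second derivative, the quantity `f'² + W |f|`
grows at most by a constant factor. -/
lemma exists_sq_add_le_of_pinched {κ₁ κ₂ : ℝ} (hκ₁ : 0 < κ₁) (hκ₂ : 0 < κ₂) :
    ∃ C : ℝ, 0 < C ∧ ∀ (W s r : ℝ) (f f₁ f₂ : ℝ → ℝ), 0 < W → s ≤ r →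
      (∀ τ ∈ Icc s r, HasDerivWithinAt f (f₁ τ) (Icc s r) τ) →
      (∀ τ ∈ Icc s r, HasDerivWithinAt f₁ (f₂ τ) (Icc s r) τ) →
      (∀ τ ∈ Ioo s r, κ₁ * W ≤ f₂ τ) → (∀ τ ∈ Ioo s r, f₂ τ ≤ κ₂ * W) →
      f s ≤ 0 → f r ≤ 0 →
      f₁ r ^ 2 + W * (-f r) ≤ C * (f₁ s ^ 2 + W * (-f s)) := by
  set D := 4 / κ₁ * (1 + 1 / κ₁) with hD
  have hD0 : 0 < D := by positivity
  refine ⟨3 + (2 * κ₂ ^ 2 + 1) * D, by positivity, ?_⟩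
  intro W s r f f₁ f₂ hW hsr hf hf₁ hl hu hs hr
  obtain ⟨h1, h2⟩ := second_order_lower_bound hsr hf hf₁ hl
  obtain ⟨h3, -⟩ := second_order_lower_bound (f := fun τ => -f τ) (f₁ := fun τ => -f₁ τ)
    (f₂ := fun τ => -f₂ τ) (l := -(κ₂ * W)) hsr (fun τ hτ => (hf τ hτ).neg)
    (fun τ hτ => (hf₁ τ hτ).neg) (fun τ hτ => neg_le_neg (hu τ hτ))
  set P := f₁ s
  set x := W * (r - s) with hx
  have hx0 : 0 ≤ x := mul_nonneg hW.le (sub_nonneg.2 hsr)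
  set F := W * (-f s) with hF
  have hF0 : 0 ≤ F := mul_nonneg hW.le (neg_nonneg.2 hs)
  -- As `f r ≤ 0`, convexity limits the elapsed time in terms of the data at `s`. The rescaled time
  -- `x = W (r - s)` removes `W` from all constants.
  have e1 : κ₁ / 2 * x ^ 2 ≤ F - P * x := by
    have : 0 ≤ W * (f r - (f s + P * (r - s) + κ₁ * W / 2 * (r - s) ^ 2)) :=
      mul_nonneg hW.le (by linarith)
    have : 0 ≤ W * (-f r) := mul_nonneg hW.le (by linarith)
    rw [hx, hF]; nlinarith
  have e2 : x ^ 2 ≤ D * (P ^ 2 + F) := by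
    have h : κ₁ / 4 * x ^ 2 ≤ F + P ^ 2 / κ₁ := by
      have : 0 ≤ (κ₁ / 2 * x + P) ^ 2 / κ₁ := by positivity
      have e : (κ₁ / 2 * x + P) ^ 2 / κ₁ = κ₁ / 4 * x ^ 2 + P * x + P ^ 2 / κ₁ := by
        field_simp; ring
      linarith
    have h' : x ^ 2 ≤ 4 / κ₁ * (F + P ^ 2 / κ₁) := by
      calc x ^ 2 = 4 / κ₁ * (κ₁ / 4 * x ^ 2) := by field_simp
        _ ≤ _ := by gcongr
    refine h'.trans ?_
    rw [hD, mul_assoc]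
    gcongr
    have : 0 ≤ F / κ₁ := by positivity
    have e : (1 + 1 / κ₁) * (P ^ 2 + F) = F + P ^ 2 / κ₁ + (P ^ 2 + F / κ₁) := by field_simp; ring
    rw [e]; linarith [sq_nonneg P]
  have e3 : f₁ r ^ 2 ≤ 2 * P ^ 2 + 2 * κ₂ ^ 2 * x ^ 2 := by
    have hlo : P ≤ f₁ r := by
      have : 0 ≤ κ₁ * W * (r - s) := by
        rw [mul_assoc]; exact mul_nonneg hκ₁.le hx0
      linarith
    have hup : f₁ r ≤ P + κ₂ * x := by rw [hx]; linarith
    have habs : |f₁ r| ≤ |P| + κ₂ * x := by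
      have := mul_nonneg hκ₂.le hx0
      exact abs_le.2 ⟨by linarith [neg_abs_le P], by linarith [le_abs_self P]⟩
    have := pow_le_pow_left₀ (abs_nonneg _) habs 2
    rw [sq_abs] at this
    nlinarith [sq_nonneg (|P| - κ₂ * x), sq_abs P]
  have e4 : W * (-f r) ≤ F + P ^ 2 + x ^ 2 := by
    have : 0 ≤ W * (f r - (f s + P * (r - s) + κ₁ * W / 2 * (r - s) ^ 2)) :=
      mul_nonneg hW.le (by linarith)
    have h5 : W * (-f r) ≤ F - P * x := by
      rw [hx, hF]
      have : 0 ≤ W * (κ₁ * W / 2 * (r - s) ^ 2) := by positivity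
      nlinarith
    nlinarith [sq_nonneg (P + x), sq_nonneg P, sq_nonneg x]
  nlinarith [mul_le_mul_of_nonneg_left e2 (by positivity : (0 : ℝ) ≤ 2 * κ₂ ^ 2 + 1)]

/-- A stopping time. It serves twice: for the first time the depth reaches a given level, and for
the first time a slope drops to `p / 2`. -/
lemma exists_first_le {f : ℝ → ℝ} {s b η : ℝ} (hsb : s ≤ b) (hf : ContinuousOn f (Icc s b)) :
    ∃ r ∈ Icc s b, (r = b ∨ f r ≤ η) ∧ ∀ τ ∈ Ico s r, η < f τ := by
  by_cases h : ∃ τ ∈ Icc s b, f τ ≤ η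
  · have hc : IsCompact (Icc s b ∩ f ⁻¹' Iic η) :=
      isCompact_Icc.of_isClosed_subset (hf.preimage_isClosed_of_isClosed isClosed_Icc isClosed_Iic)
        inter_subset_left
    obtain ⟨r, hr, hmin⟩ := hc.exists_isLeast h
    refine ⟨r, hr.1, Or.inr hr.2, fun τ hτ => ?_⟩
    by_contra! hle
    exact absurd (hmin ⟨⟨hτ.1, hτ.2.le.trans hr.1.2⟩, hle⟩) (not_le.2 hτ.2)
  · push Not at h
    exact ⟨b, right_mem_Icc.2 hsb, Or.inl rfl, fun τ hτ => h τ ⟨hτ.1, hτ.2.le⟩⟩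

/-- The grazing quantity at the final time is controlled by the one at any earlier time, since the
trajectory either remains near the boundary or crosses the level `-η`. -/
lemma exists_sq_le_sq_add {κ₁ κ₂ η C' c : ℝ} (hκ₁ : 0 < κ₁) (hκ₂ : 0 < κ₂) (hη : 0 < η)
    (hC' : 0 < C') :
    ∃ C : ℝ, 0 < C ∧ ∀ (W α a b : ℝ) (f f₁ f₂ : ℝ → ℝ), 1 ≤ W →
      (∀ τ ∈ Icc a b, HasDerivWithinAt f (f₁ τ) (Icc a b) τ) →
      (∀ τ ∈ Icc a b, HasDerivWithinAt f₁ (f₂ τ) (Icc a b) τ) →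
      (∀ τ ∈ Icc a b, f τ ≤ 0) →
      (∀ τ ∈ Icc a b, -η ≤ f τ → κ₁ * W ≤ f₂ τ) → (∀ τ ∈ Icc a b, f₂ τ ≤ κ₂ * W) →
      0 ≤ α → α ≤ c → α ^ 2 ≤ C' * (f₁ b ^ 2 + W * (-f b)) →
      ∀ s ∈ Icc a b, α ^ 2 ≤ C * (f₁ s ^ 2 + W * (-f s)) := by
  obtain ⟨D, hD, H⟩ := exists_sq_add_le_of_pinched hκ₁ hκ₂
  -- `C'` serves when the trajectory stays above `-η` up to time `b`. If it reaches `-η`, then `W ≥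
  -- 1` makes the quantity there at least `η`, and `α ≤ c` gives the factor `c ^ 2 / η`.
  refine ⟨(C' + c ^ 2 / η) * D, by positivity, ?_⟩
  intro W α a b f f₁ f₂ hW hf hf₁ hneg hl hu hα hαc hαb s hs
  have hsub : Icc s b ⊆ Icc a b := Icc_subset_Icc_left hs.1
  obtain ⟨r, hr, hend, hlt⟩ := exists_first_le (η := -η) hs.2
    (fun τ hτ => (hf τ (hsub hτ)).continuousWithinAt.mono hsub)
  have hsub' : Icc s r ⊆ Icc a b := Icc_subset_Icc hs.1 hr.2
  have hQ := H W s r f f₁ f₂ (by linarith) hr.1 (fun τ hτ => (hf τ (hsub' hτ)).mono hsub')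
    (fun τ hτ => (hf₁ τ (hsub' hτ)).mono hsub')
    (fun τ hτ => hl τ (hsub' (Ioo_subset_Icc_self hτ)) (hlt τ ⟨hτ.1.le, hτ.2⟩).le)
    (fun τ hτ => hu τ (hsub' (Ioo_subset_Icc_self hτ))) (hneg s hs) (hneg r (hsub hr))
  have hr0 : 0 ≤ f₁ r ^ 2 + W * (-f r) :=
    add_nonneg (sq_nonneg _) (mul_nonneg (by linarith) (by linarith [hneg r (hsub hr)]))
  have key : α ^ 2 ≤ (C' + c ^ 2 / η) * (f₁ r ^ 2 + W * (-f r)) := by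
    rw [add_mul]
    rcases hend with rfl | hle
    · have : 0 ≤ c ^ 2 / η * (f₁ r ^ 2 + W * (-f r)) := by positivity
      linarith
    · have h1 : η ≤ f₁ r ^ 2 + W * (-f r) := by
        nlinarith [sq_nonneg (f₁ r)]
      have h2 : c ^ 2 = c ^ 2 / η * η := by field_simp
      have h3 : c ^ 2 / η * η ≤ c ^ 2 / η * (f₁ r ^ 2 + W * (-f r)) := by gcongr
      have h4 : α ^ 2 ≤ c ^ 2 := pow_le_pow_left₀ hα hαc 2
      have : 0 ≤ C' * (f₁ r ^ 2 + W * (-f r)) := by positivity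
      linarith
  calc α ^ 2 ≤ _ := key
    _ ≤ (C' + c ^ 2 / η) * (D * (f₁ s ^ 2 + W * (-f s))) := by gcongr
    _ = _ := by ring

/-- If `|f'| ≥ p` wherever `f ≥ -θ`, then from such a point with `f' > 0` the function keeps
increasing at rate at least `p / 2`. -/
lemma mul_sub_le_neg_of_deriv_pos {f f₁ : ℝ → ℝ} {s b p θ : ℝ} (hsb : s ≤ b) (hp : 0 < p)
    (hf : ∀ τ ∈ Icc s b, HasDerivWithinAt f (f₁ τ) (Icc s b) τ) (hc : ContinuousOn f₁ (Icc s b))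
    (hb : f b ≤ 0) (hsteep : ∀ τ ∈ Icc s b, -θ ≤ f τ → p ≤ |f₁ τ|) (hs : -θ ≤ f s)
    (hpos : 0 < f₁ s) : p / 2 * (b - s) ≤ -f s := by
  have mono : ∀ r ∈ Icc s b, (∀ τ ∈ Ico s r, p / 2 < f₁ τ) → f s + p / 2 * (r - s) ≤ f r := by
    intro r hr h
    have hsub : Icc s r ⊆ Icc s b := Icc_subset_Icc_right hr.2
    have hm : MonotoneOn (fun τ => f τ - p / 2 * τ) (Icc s r) := by
      refine monotoneOn_of_hasDerivWithinAt_nonneg (f' := fun τ => f₁ τ - p / 2 * 1)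
        (convex_Icc s r) (fun τ hτ => (((hf τ (hsub hτ)).continuousWithinAt.mono hsub).sub
          (by fun_prop))) (fun τ hτ => ?_) (fun τ hτ => ?_)
      · exact (((hf τ (hsub (interior_subset hτ))).mono hsub).sub
          ((hasDerivWithinAt_id τ _).const_mul (p / 2))).mono interior_subset
      · rw [interior_Icc] at hτ
        linarith [h τ ⟨hτ.1.le, hτ.2⟩]
    have := hm (left_mem_Icc.2 hr.1) (right_mem_Icc.2 hr.1) hr.1
    simp only at this
    linarith
  have hs1 : p ≤ f₁ s := by
    have := hsteep s (left_mem_Icc.2 hsb) hs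
    rwa [abs_of_pos hpos] at this
  obtain ⟨r, hr, hend, hlt⟩ := exists_first_le (η := p / 2) hsb hc
  have hfr := mono r hr hlt
  rcases hend with rfl | hle
  · linarith
  · exfalso
    have hge : -θ ≤ f r := by
      have : 0 ≤ p / 2 * (r - s) := mul_nonneg (by linarith) (by linarith [hr.1])
      linarith
    have habs := hsteep r hr hge
    -- By continuity the slope at the stopping time is exactly `p / 2`; but `f` has only increased,
    -- so the depth is still at most `θ` and the slope should be at least `p`.
    obtain ⟨τ, hτ, hτe⟩ := intermediate_value_Icc' hr.1
      (hc.mono (Icc_subset_Icc_right hr.2)) ⟨hle, by linarith⟩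
    rcases hτ.2.lt_or_eq with h | h
    · exact absurd hτe (hlt τ ⟨hτ.1, h⟩).ne'
    · rw [← h, hτe, abs_of_pos (by linarith)] at habs
      linarith

/-- The slope at `s` cannot vanish, and its sign decides the end: if positive, `f` rises steadily
until `b`; if negative, the same holds after time reversal, until `a`. -/
lemma mul_sub_le_neg_or {f f₁ : ℝ → ℝ} {a b p θ : ℝ} (hp : 0 < p)
    (hf : ∀ τ ∈ Icc a b, HasDerivWithinAt f (f₁ τ) (Icc a b) τ) (hc : ContinuousOn f₁ (Icc a b))
    (hneg : ∀ τ ∈ Icc a b, f τ ≤ 0) (hsteep : ∀ τ ∈ Icc a b, -θ ≤ f τ → p ≤ |f₁ τ|) {s : ℝ}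
    (hs : s ∈ Icc a b) (hsθ : -θ ≤ f s) :
    p / 2 * (s - a) ≤ -f s ∨ p / 2 * (b - s) ≤ -f s := by
  rcases lt_trichotomy (f₁ s) 0 with h | h | h
  · left
    have hsub : Icc a s ⊆ Icc a b := Icc_subset_Icc_right hs.2
    have hmaps : MapsTo (fun τ : ℝ => -τ) (Icc (-s) (-a)) (Icc a s) :=
      fun τ hτ => ⟨by linarith [hτ.2], by linarith [hτ.1]⟩
    have := mul_sub_le_neg_of_deriv_pos (f := fun τ => f (-τ)) (f₁ := fun τ => -f₁ (-τ))
      (s := -s) (b := -a) (p := p) (θ := θ) (by linarith [hs.1]) hp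
      (fun τ hτ => by
        have h1 := ((hf (-τ) (hsub (hmaps hτ))).mono hsub).scomp τ
          ((hasDerivAt_neg τ).hasDerivWithinAt) hmaps
        simpa [Function.comp_def] using h1)
      ((hc.mono hsub).comp continuous_neg.continuousOn hmaps).neg
      (by simpa using hneg a (left_mem_Icc.2 (hs.1.trans hs.2)))
      (fun τ hτ hθ => by rw [abs_neg]; exact hsteep _ (hsub (hmaps hτ)) hθ)
      (by simpa using hsθ) (by simpa using h)
    simp only [neg_neg] at this
    linarith
  · have := hsteep s hs hsθ
    rw [h, abs_zero] at this
    linarith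
  · right
    have hsub : Icc s b ⊆ Icc a b := Icc_subset_Icc_left hs.1
    exact mul_sub_le_neg_of_deriv_pos hs.2 hp (fun τ hτ => (hf τ (hsub hτ)).mono hsub)
      (hc.mono hsub) (hneg b (right_mem_Icc.2 (hs.1.trans hs.2)))
      (fun τ hτ => hsteep τ (hsub hτ)) hsθ h

/-! ### Geometry of the domain and the field near its boundary -/

/-- On a compact set, `g` is small where `h` is small if `g` vanishes where `h` does. -/
lemma IsCompact.exists_lt_imp_lt {X : Type*} [TopologicalSpace X] {K : Set X} (hK : IsCompact K)
    {g h : X → ℝ} (hg : ContinuousOn g K) (hh : ContinuousOn h K) (h0 : ∀ x ∈ K, 0 ≤ h x)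
    (hgh : ∀ x ∈ K, h x = 0 → g x ≤ 0) {ε : ℝ} (hε : 0 < ε) :
    ∃ δ : ℝ, 0 < δ ∧ ∀ x ∈ K, h x < δ → g x < ε := by
  have hc : IsCompact (K ∩ g ⁻¹' Ici ε) := by
    obtain ⟨u, hu, hu'⟩ := continuousOn_iff_isClosed.1 hg (Ici ε) isClosed_Ici
    rw [inter_comm, hu']
    exact hK.inter_left hu
  obtain ⟨δ, hδ, H⟩ := hc.exists_forall_le' (hh.mono inter_subset_left) (a := 0) fun x hx =>
    (h0 x hx.1).lt_of_ne fun e => absurd (hgh x hx.1 e.symm) (not_le.2 (hε.trans_le hx.2))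
  refine ⟨δ, hδ, fun x hx hlt => ?_⟩
  by_contra! hge
  exact absurd (H x ⟨hx, hge⟩) (not_le.2 hlt)

namespace KineticDomain

variable {ξ : R3 → ℝ}

lemma inner_gradient (ξ : R3 → ℝ) (y w : R3) : inner ℝ w (gradient ξ y) = fderiv ℝ ξ y w := by
  rw [inner_gradient_right]; simp

lemma mem_dom_or_mem_frontier {y : R3} (hy : y ∈ closure (dom ξ)) :
    y ∈ dom ξ ∨ y ∈ frontier (dom ξ) := by
  rwa [closure_eq_self_union_frontier] at hy

namespace IsStrictlyConvexDomain

lemma continuous (hξ : IsStrictlyConvexDomain ξ) : Continuous ξ := hξ.contDiff.continuous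

lemma isOpen_dom (hξ : IsStrictlyConvexDomain ξ)
    : IsOpen (dom ξ) := isOpen_lt hξ.continuous continuous_const

lemma isCompact_closure (hξ : IsStrictlyConvexDomain ξ)
    : IsCompact (closure (dom ξ)) := hξ.bounded.isCompact_closure

lemma isCompact_frontier (hξ : IsStrictlyConvexDomain ξ) : IsCompact (frontier (dom ξ)) :=
  hξ.isCompact_closure.of_isClosed_subset isClosed_frontier frontier_subset_closure

lemma nonpos (hξ : IsStrictlyConvexDomain ξ) {y : R3} (hy : y ∈ closure (dom ξ)) : ξ y ≤ 0 :=
  closure_lt_subset_le hξ.continuous continuous_const hy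

lemma mem_frontier (hξ : IsStrictlyConvexDomain ξ) {y : R3} : y ∈ frontier (dom ξ) ↔ ξ y = 0 := by
  rw [hξ.frontier_eq]; rfl

lemma frontier_nonempty (hξ : IsStrictlyConvexDomain ξ)
    (h : (dom ξ).Nonempty) : (frontier (dom ξ)).Nonempty := by
  rw [nonempty_frontier_iff]
  refine ⟨h, fun hu => ?_⟩
  have := hξ.bounded
  rw [hu] at this
  exact NormedSpace.unbounded_univ ℝ R3 this

lemma nearest_spec (hξ : IsStrictlyConvexDomain ξ) (h : (dom ξ).Nonempty) (x : R3) :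
    nearest ξ x ∈ frontier (dom ξ) ∧
      dist x (nearest ξ x) = Metric.infDist x (frontier (dom ξ)) := by
  obtain ⟨y, hy, hd⟩ := hξ.isCompact_frontier.exists_infDist_eq_dist (hξ.frontier_nonempty h) x
  exact Classical.epsilon_spec (p := fun y => y ∈ frontier (dom ξ) ∧
    dist x y = Metric.infDist x (frontier (dom ξ))) ⟨y, hy, hd.symm⟩

lemma infDist_pos (hξ : IsStrictlyConvexDomain ξ)
    {x : R3} (hx : x ∈ dom ξ) : 0 < Metric.infDist x (frontier (dom ξ)) := by
  rw [← isClosed_frontier.notMem_iff_infDist_pos (hξ.frontier_nonempty ⟨x, hx⟩)]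
  intro h
  exact (hξ.mem_frontier.1 h).not_lt hx

/-- The ball misses the frontier, so by connectedness it stays on the side of its centre. Convexity
of the domain is not needed for this. -/
lemma ball_subset (hξ : IsStrictlyConvexDomain ξ) {x : R3} (hx : x ∈ dom ξ) :
    Metric.ball x (Metric.infDist x (frontier (dom ξ))) ⊆ dom ξ := by
  have hpos := hξ.infDist_pos hx
  refine (convex_ball x _).isPreconnected.subset_left_of_subset_union hξ.isOpen_dom
    (isClosed_closure (s := dom ξ)).isOpen_compl
    (disjoint_compl_right.mono_left subset_closure) (fun y hy => ?_)
    ⟨x, Metric.mem_ball_self hpos, hx⟩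
  by_cases hc : y ∈ closure (dom ξ)
  · rcases mem_dom_or_mem_frontier hc with h | h
    · exact Or.inl h
    · exact absurd h (disjoint_left.1 Metric.disjoint_ball_infDist hy)
  · exact Or.inr hc

lemma closedBall_subset (hξ : IsStrictlyConvexDomain ξ) {x : R3} (hx : x ∈ dom ξ) :
    Metric.closedBall x (Metric.infDist x (frontier (dom ξ))) ⊆ closure (dom ξ) := by
  rw [← closure_ball x (hξ.infDist_pos hx).ne']
  exact closure_mono (hξ.ball_subset hx)

end IsStrictlyConvexDomain

/-- Quantitative bounds on the defining function over the closure of the domain. -/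
structure DomainBounds (ξ : R3 → ℝ) (h H L c₁ ρ : ℝ) : Prop where
  h_pos : 0 < h
  H_pos : 0 < H
  L_pos : 0 < L
  c₁_pos : 0 < c₁
  ρ_pos : 0 < ρ
  hess_ge : ∀ y ∈ closure (dom ξ), ∀ ζ : R3, h * ‖ζ‖ ^ 2 ≤ hess ξ y ζ
  norm_hess_le : ∀ y ∈ closure (dom ξ), ‖fderiv ℝ (fderiv ℝ ξ) y‖ ≤ H
  norm_fderiv_le : ∀ y ∈ closure (dom ξ), ‖fderiv ℝ ξ y‖ ≤ L
  abs_le : ∀ y ∈ closure (dom ξ), |ξ y| ≤ L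
  le_norm_gradient : ∀ y ∈ closure (dom ξ), |ξ y| ≤ ρ → c₁ ≤ ‖gradient ξ y‖

namespace IsStrictlyConvexDomain

lemma contDiff_fderiv (hξ : IsStrictlyConvexDomain ξ) : ContDiff ℝ 2 (fderiv ℝ ξ) :=
  hξ.contDiff.fderiv_right (by norm_num)

lemma continuous_gradient (hξ : IsStrictlyConvexDomain ξ) : Continuous (gradient ξ) :=
  (InnerProductSpace.toDual ℝ R3).symm.continuous.comp hξ.contDiff_fderiv.continuous

lemma exists_domainBounds (hξ : IsStrictlyConvexDomain ξ)
    : ∃ h H L c₁ ρ : ℝ, DomainBounds ξ h H L c₁ ρ := by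
  obtain ⟨h, hh, hhess⟩ := hξ.hess_pos
  obtain ⟨η, hη, hgrad⟩ := hξ.gradient_ne
  have hK := hξ.isCompact_closure
  obtain ⟨H, hH⟩ := hK.exists_bound_of_continuousOn
    (hξ.contDiff_fderiv.continuous_fderiv (by norm_num)).continuousOn
  obtain ⟨L₁, hL₁⟩ := hK.exists_bound_of_continuousOn hξ.contDiff_fderiv.continuous.continuousOn
  obtain ⟨L₂, hL₂⟩ := hK.exists_bound_of_continuousOn hξ.continuous.continuousOn
  have hc : IsCompact (closure (dom ξ) ∩ {y | |ξ y| ≤ η / 2}) :=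
    hK.inter_right (isClosed_le hξ.continuous.abs continuous_const)
  obtain ⟨c₁, hc₁, hc₁'⟩ := hc.exists_forall_le' hξ.continuous_gradient.norm.continuousOn
    (a := 0) (fun y hy => norm_pos_iff.2
      (hgrad y hy.1 (lt_of_le_of_lt hy.2 (by linarith))))
  refine ⟨h, max H 1, max (max L₁ L₂) 1, c₁, η / 2, hh, by positivity, by positivity, hc₁,
    by positivity, hhess, fun y hy => (hH y hy).trans (le_max_left _ _),
    fun y hy => (hL₁ y hy).trans ((le_max_left _ _).trans (le_max_left _ _)),
    fun y hy => (hL₂ y hy).trans ((le_max_right _ _).trans (le_max_left _ _)),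
    fun y hy hle => hc₁' y ⟨hy, hle⟩⟩

lemma exists_infDist_lt (hξ : IsStrictlyConvexDomain ξ) {d : ℝ} (hd : 0 < d) :
    ∃ η : ℝ, 0 < η ∧ ∀ y ∈ closure (dom ξ), |ξ y| < η →
      Metric.infDist y (frontier (dom ξ)) < d :=
  hξ.isCompact_closure.exists_lt_imp_lt (Metric.continuous_infDist_pt _).continuousOn
    hξ.continuous.abs.continuousOn (fun _ _ => abs_nonneg _)
    (fun _ _ h => (Metric.infDist_zero_of_mem (hξ.mem_frontier.2 (abs_eq_zero.1 h))).le) hd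

lemma exists_abs_lt (hξ : IsStrictlyConvexDomain ξ) {η : ℝ} (hη : 0 < η) :
    ∃ d : ℝ, 0 < d ∧ ∀ y ∈ closure (dom ξ), Metric.infDist y (frontier (dom ξ)) < d →
      |ξ y| < η := by
  refine hξ.isCompact_closure.exists_lt_imp_lt hξ.continuous.abs.continuousOn
    (Metric.continuous_infDist_pt _).continuousOn (fun _ _ => Metric.infDist_nonneg)
    (fun y hy h => ?_) hη
  rcases mem_dom_or_mem_frontier hy with h' | h'
  · exact absurd h (hξ.infDist_pos h').ne'
  · rw [hξ.mem_frontier.1 h', abs_zero]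

/-- Points of every small depth exist, so that `collarDepth` is a genuine minimum. -/
lemma exists_collarDepth_pos (hξ : IsStrictlyConvexDomain ξ) (hne : (dom ξ).Nonempty) :
    ∃ r₀ : ℝ, 0 < r₀ ∧ ∀ r, 0 < r → r < r₀ → 0 < collarDepth ξ r := by
  obtain ⟨x, hx⟩ := hne
  refine ⟨_, hξ.infDist_pos hx, fun r hr hr' => ?_⟩
  set S := {x | x ∈ dom ξ ∧ Metric.infDist x (frontier (dom ξ)) = r} with hS
  have hSeq : S = closure (dom ξ) ∩ {x | Metric.infDist x (frontier (dom ξ)) = r} := by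
    ext y
    refine ⟨fun hy => ⟨subset_closure hy.1, hy.2⟩, fun hy => ⟨?_, hy.2⟩⟩
    rcases mem_dom_or_mem_frontier hy.1 with h | h
    · exact h
    · have := hy.2
      rw [mem_ofPred_eq, Metric.infDist_zero_of_mem h] at this
      exact absurd this hr.ne
  have hSc : IsCompact S := by
    rw [hSeq]
    exact hξ.isCompact_closure.inter_right
      (isClosed_eq (Metric.continuous_infDist_pt _) continuous_const)
  have hSne : S.Nonempty := by
    obtain ⟨hz, hzd⟩ := hξ.nearest_spec ⟨x, hx⟩ x
    set z := nearest ξ x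
    -- On the segment from `x` to its nearest boundary point, the distance to the boundary takes
    -- every value between `0` and its value at `x`.
    have hseg : segment ℝ x z ⊆ closure (dom ξ) := by
      refine ((convex_closedBall x _).segment_subset
        (Metric.mem_closedBall_self Metric.infDist_nonneg) ?_).trans (hξ.closedBall_subset hx)
      rw [Metric.mem_closedBall, dist_comm, hzd]
    obtain ⟨y, hy, hyr⟩ := (convex_segment x z).isPreconnected.intermediate_value
      (right_mem_segment ℝ x z) (left_mem_segment ℝ x z)
      (f := fun y => Metric.infDist y (frontier (dom ξ)))
      (Metric.continuous_infDist_pt _).continuousOn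
      (show r ∈ Icc _ _ from ⟨by simp only [Metric.infDist_zero_of_mem hz]; exact hr.le, hr'.le⟩)
    rw [hSeq]
    exact ⟨y, hseg hy, hyr⟩
  obtain ⟨m, hm, hm'⟩ := hSc.exists_forall_le' hξ.continuous.abs.continuousOn (a := 0)
    (fun y hy => abs_pos.2 (ne_of_lt hy.1))
  refine hm.trans_le (le_csInf (hSne.image _) ?_)
  rintro _ ⟨y, hy, rfl⟩
  exact hm' y hy

end IsStrictlyConvexDomain

namespace IsAdmissibleField

variable {T CE M : ℝ} {E : ℝ → R3 → R3}

lemma supNorm_le (hE : IsAdmissibleField ξ T CE M E) : supNorm ξ T E ≤ ENNReal.ofReal M :=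
  (le_self_add.trans le_self_add).trans hE.bound

lemma gradNorm_le (hE : IsAdmissibleField ξ T CE M E) : gradNorm ξ T E ≤ ENNReal.ofReal M :=
  (le_add_self.trans le_self_add).trans hE.bound

lemma toReal_supNorm_le (hE : IsAdmissibleField ξ T CE M E) : (supNorm ξ T E).toReal ≤ max M 0 := by
  have := ENNReal.toReal_mono ENNReal.ofReal_ne_top hE.supNorm_le
  rwa [ENNReal.toReal_ofReal'] at this

lemma norm_le_of_mem_dom (hE : IsAdmissibleField ξ T CE M E)
    {t : ℝ} (ht : t ∈ Icc 0 T) {y : R3} (hy : y ∈ dom ξ) :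
    ‖E t y‖ ≤ max M 0 := by
  have h : ‖E t y‖ₑ ≤ ENNReal.ofReal M :=
    (le_iSup₂_of_le t ht (le_iSup₂_of_le (f := fun x (_ : x ∈ dom ξ) => ‖E t x‖ₑ) y hy le_rfl)).trans
      hE.supNorm_le
  have := ENNReal.toReal_mono ENNReal.ofReal_ne_top h
  rwa [ENNReal.toReal_ofReal', toReal_enorm] at this

lemma norm_fderiv_le (hE : IsAdmissibleField ξ T CE M E)
    {t : ℝ} (ht : t ∈ Icc 0 T) {y : R3} (hy : y ∈ dom ξ) :
    ‖fderiv ℝ (E t) y‖ ≤ max M 0 := by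
  have h : ‖fderiv ℝ (E t) y‖ₑ ≤ ENNReal.ofReal M :=
    (le_iSup₂_of_le t ht (le_iSup₂_of_le (f := fun x (_ : x ∈ dom ξ) => ‖fderiv ℝ (E t) x‖ₑ)
      y hy le_rfl)).trans hE.gradNorm_le
  have := ENNReal.toReal_mono ENNReal.ofReal_ne_top h
  rwa [ENNReal.toReal_ofReal', toReal_enorm] at this

lemma continuousOn_slice (hE : IsAdmissibleField ξ T CE M E)
    {t : ℝ} (ht : t ∈ Icc 0 T) : ContinuousOn (E t) (closure (dom ξ)) :=
  hE.continuousOn.comp (f := fun y => (t, y)) (by fun_prop) fun _ hy => ⟨ht, hy⟩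

lemma norm_le (hE : IsAdmissibleField ξ T CE M E)
    {t : ℝ} (ht : t ∈ Icc 0 T) {y : R3} (hy : y ∈ closure (dom ξ)) :
    ‖E t y‖ ≤ max M 0 :=
  le_on_closure (fun _ => hE.norm_le_of_mem_dom ht) (hE.continuousOn_slice ht).norm
    continuousOn_const hy

/-- The field is differentiable only inside the domain and the nearest point lies on its boundary.
The mean value inequality holds on the open ball around `y` that touches the boundary, and
continuity carries it to the closed ball. -/
lemma norm_sub_nearest_le (hE : IsAdmissibleField ξ T CE M E)
    (hξ : IsStrictlyConvexDomain ξ) {t : ℝ} (ht : t ∈ Icc 0 T) {y : R3}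
    (hy : y ∈ dom ξ) :
    ‖E t (nearest ξ y) - E t y‖ ≤ max M 0 * ‖nearest ξ y - y‖ := by
  obtain ⟨-, hd⟩ := hξ.nearest_spec ⟨y, hy⟩ y
  have hpos := hξ.infDist_pos hy
  set d := Metric.infDist y (frontier (dom ξ))
  have hball := hξ.ball_subset hy
  have hcl : closure (Metric.ball y d) ⊆ closure (dom ξ) := closure_mono hball
  refine le_on_closure (s := Metric.ball y d) (f := fun z => ‖E t z - E t y‖)
    (g := fun z => max M 0 * ‖z - y‖) (fun z hz => ?_)
    (((hE.continuousOn_slice ht).mono hcl).sub continuousOn_const).norm (by fun_prop) ?_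
  · exact (convex_ball y d).norm_image_sub_le_of_norm_fderiv_le
      (fun w hw => (hE.differentiable_x t ht).differentiableAt
        (hξ.isOpen_dom.mem_nhds (hball hw)))
      (fun w hw => hE.norm_fderiv_le ht (hball hw)) (Metric.mem_ball_self hpos) hz
  · rw [closure_ball y hpos.ne', Metric.mem_closedBall, dist_comm, hd]

lemma lt_inner_gradient (hE : IsAdmissibleField ξ T CE M E)
    {h H L c₁ ρ : ℝ} (hb : DomainBounds ξ h H L c₁ ρ)
    (hξ : IsStrictlyConvexDomain ξ) (hCE : 0 < CE) {t : ℝ}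
    (ht : t ∈ Icc 0 T) {y : R3} (hy : y ∈ frontier (dom ξ)) :
    CE * c₁ < inner ℝ (E t y) (gradient ξ y) := by
  have hc := hb.le_norm_gradient y (frontier_subset_closure hy)
    (by rw [hξ.mem_frontier.1 hy, abs_zero]; exact hb.ρ_pos.le)
  have hpos := hb.c₁_pos.trans_le hc
  have hs := hE.sign t ht y hy
  rw [normal, real_inner_smul_right, inv_mul_eq_div, lt_div_iff₀ hpos] at hs
  exact (mul_le_mul_of_nonneg_left hc hCE.le).trans_lt hs

end IsAdmissibleField

/-- The sign condition persists, with half the constant, in a neighbourhood of the boundary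
which depends on the field only through its bound. -/
lemma exists_le_fderiv_apply {h H L c₁ ρ : ℝ} (hb : DomainBounds ξ h H L c₁ ρ)
    (hξ : IsStrictlyConvexDomain ξ) {CE : ℝ} (hCE : 0 < CE) (M : ℝ) :
    ∃ η : ℝ, 0 < η ∧ ∀ T E, IsAdmissibleField ξ T CE M E → ∀ t ∈ Icc 0 T,
      ∀ y ∈ closure (dom ξ), |ξ y| < η → CE * c₁ / 2 ≤ fderiv ℝ ξ y (E t y) := by
  have hc₁ := hb.c₁_pos
  set M' := max M 0
  have hM' : 0 ≤ M' := le_max_right _ _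
  set A := (H + L) * M' with hA
  have hA0 : 0 ≤ A := by have := hb.H_pos; have := hb.L_pos; positivity
  -- `A` bounds the change of `E·∇ξ` per unit distance to the nearest boundary point, so at this
  -- distance at most half of `CE * c₁` is lost; `A + 1` avoids a zero denominator.
  obtain ⟨η, hη, hdist⟩ := hξ.exists_infDist_lt
    (d := CE * c₁ / (2 * (A + 1))) (by positivity)
  refine ⟨η, hη, fun T E hE t ht y hy hlt => ?_⟩
  have hd := hdist y hy hlt
  rcases mem_dom_or_mem_frontier hy with hy' | hy'
  · obtain ⟨hz, hzd⟩ := hξ.nearest_spec ⟨y, hy'⟩ y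
    have hE' := hE.norm_sub_nearest_le hξ ht hy'
    have hs := hE.lt_inner_gradient hb hξ hCE ht hz
    rw [inner_gradient] at hs
    have hcb := hξ.closedBall_subset hy'
    set d := Metric.infDist y (frontier (dom ξ))
    set z := nearest ξ y
    have hzy : ‖z - y‖ = d := by rw [← dist_eq_norm, dist_comm, hzd]
    rw [hzy] at hE'
    have hg : ‖fderiv ℝ ξ z - fderiv ℝ ξ y‖ ≤ H * d := by
      rw [← hzy]
      refine (convex_closedBall y d).norm_image_sub_le_of_norm_fderiv_le
        (fun w _ => (hξ.contDiff_fderiv.differentiable (by norm_num)) w)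
        (fun w hw => hb.norm_hess_le w (hcb hw))
        (Metric.mem_closedBall_self Metric.infDist_nonneg) ?_
      rw [Metric.mem_closedBall, dist_comm, hzd]
    have hd0 : 0 ≤ d := Metric.infDist_nonneg
    have h1 : (fderiv ℝ ξ z - fderiv ℝ ξ y) (E t z) ≤ H * d * M' :=
      ((Real.le_norm_self _).trans ((fderiv ℝ ξ z - fderiv ℝ ξ y).le_opNorm _)).trans
        (mul_le_mul hg (hE.norm_le ht (frontier_subset_closure hz)) (norm_nonneg _)
          (mul_nonneg hb.H_pos.le hd0))
    have h2 : fderiv ℝ ξ y (E t z - E t y) ≤ L * (M' * d) :=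
      ((Real.le_norm_self _).trans ((fderiv ℝ ξ y).le_opNorm _)).trans
        (mul_le_mul (hb.norm_fderiv_le y hy) hE' (norm_nonneg _) hb.L_pos.le)
    have h3 : fderiv ℝ ξ y (E t y) = fderiv ℝ ξ z (E t z)
        - (fderiv ℝ ξ z - fderiv ℝ ξ y) (E t z) - fderiv ℝ ξ y (E t z - E t y) := by
      rw [map_sub, _root_.sub_apply]; ring
    have h4 : A * d ≤ CE * c₁ / 2 := by
      have : (A + 1) * d ≤ (A + 1) * (CE * c₁ / (2 * (A + 1))) := by gcongr
      have e : (A + 1) * (CE * c₁ / (2 * (A + 1))) = CE * c₁ / 2 := by field_simp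
      linarith
    rw [h3]
    rw [hA] at h4
    linarith
  · have := hE.lt_inner_gradient hb hξ hCE ht hy'
    rw [inner_gradient] at this
    have : 0 < CE * c₁ := by positivity
    linarith

end KineticDomain

/-! ### Two-sided bounds for the cutoff and the kinetic distance -/

namespace KineticDomain

variable {ξ : R3 → ℝ}

namespace IsCutoff

variable {ε c : ℝ} {χ : ℝ → ℝ}

/-- Monotonicity passes to the end points by continuity; they are where `χ` meets the identity and
the constant. -/
lemma monotoneOn_Icc (hχ : IsCutoff ε c χ) (hε : 0 < ε) : MonotoneOn χ (Icc (ε / 4) (ε / 2)) := by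
  have hc : ContinuousOn χ (Icc (ε / 4) (ε / 2)) :=
    hχ.smooth.continuousOn.mono fun y hy => le_trans (by positivity : (0 : ℝ) ≤ ε / 4) hy.1
  have hcl : closure (Ioo (ε / 4) (ε / 2)) = Icc (ε / 4) (ε / 2) := closure_Ioo (by linarith)
  rw [← hcl] at hc ⊢
  have h1 : ∀ x ∈ Ioo (ε / 4) (ε / 2), ∀ y ∈ closure (Ioo (ε / 4) (ε / 2)), x ≤ y → χ x ≤ χ y := by
    intro x hx y hy hxy
    rcases hxy.eq_or_lt with rfl | hlt
    · exact le_rfl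
    have hy' : y ∈ closure (Ioo x (ε / 2)) := by
      rw [closure_Ioo hx.2.ne]
      rw [hcl] at hy
      exact ⟨hlt.le, hy.2⟩
    have hsub : Ioo x (ε / 2) ⊆ Ioo (ε / 4) (ε / 2) := Ioo_subset_Ioo_left hx.1.le
    exact le_on_closure (f := fun _ => χ x) (g := χ) (s := Ioo x (ε / 2))
      (fun z hz => hχ.mono hx (hsub hz) hz.1.le) continuousOn_const
      (hc.mono (closure_mono hsub)) hy'
  intro x hx y hy hxy
  rcases hxy.eq_or_lt with rfl | hlt
  · exact le_rfl
  have hx' : x ∈ closure (Ioo (ε / 4) y) ∨ x = ε / 4 := by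
    rw [hcl] at hx hy
    rcases hx.1.eq_or_lt with h | h
    · exact Or.inr h.symm
    · rw [closure_Ioo (h.trans hlt).ne]
      exact Or.inl ⟨h.le, hlt.le⟩
  have hxy' : x ∈ closure (Ioo x y) := by
    rw [closure_Ioo hlt.ne]; exact ⟨le_rfl, hlt.le⟩
  rw [hcl] at hx hy
  have hsub : Ioo x y ⊆ Ioo (ε / 4) (ε / 2) := Ioo_subset_Ioo hx.1 hy.2
  exact le_on_closure (f := χ) (g := fun _ => χ y) (s := Ioo x y)
    (fun z hz => h1 z (hsub hz) y (by rw [hcl]; exact hy) hz.2.le)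
    (hc.mono (closure_mono hsub)) continuousOn_const hxy'

lemma le_const (hχ : IsCutoff ε c χ) (hε : 0 < ε) : ε / 4 ≤ c := by
  have := hχ.monotoneOn_Icc hε (left_mem_Icc.2 (by linarith)) (right_mem_Icc.2 (by linarith))
    (by linarith : ε / 4 ≤ ε / 2)
  rwa [hχ.eq_id _ (by positivity) le_rfl, hχ.eq_const _ le_rfl] at this

lemma apply_le_const (hχ : IsCutoff ε c χ) (hε : 0 < ε) {y : ℝ} (hy : 0 ≤ y) : χ y ≤ c := by
  rcases le_total y (ε / 4) with h | h
  · rw [hχ.eq_id y hy h]; exact h.trans (hχ.le_const hε)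
  rcases le_total y (ε / 2) with h' | h'
  · rw [← hχ.eq_const _ le_rfl]
    exact hχ.monotoneOn_Icc hε ⟨h, h'⟩ (right_mem_Icc.2 (by linarith)) h'
  · exact (hχ.eq_const y h').le

lemma min_le_apply (hχ : IsCutoff ε c χ) (hε : 0 < ε)
    {y : ℝ} (hy : 0 ≤ y) : min y (ε / 4) ≤ χ y := by
  rcases le_total y (ε / 4) with h | h
  · rw [hχ.eq_id y hy h]; exact min_le_left _ _
  refine (min_le_right _ _).trans ?_
  rcases le_total y (ε / 2) with h' | h'
  · have := hχ.monotoneOn_Icc hε (left_mem_Icc.2 (by linarith)) ⟨h, h'⟩ h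
    rwa [hχ.eq_id _ (by positivity) le_rfl] at this
  · rw [hχ.eq_const y h']; exact hχ.le_const hε

lemma const_pos (hχ : IsCutoff ε c χ) (hε : 0 < ε)
    : 0 < c := (by positivity : 0 < ε / 4).trans_le (hχ.le_const hε)

lemma apply_le_mul (hχ : IsCutoff ε c χ) (hε : 0 < ε)
    {y : ℝ} (hy : 0 ≤ y) : χ y ≤ 4 * c / ε * y := by
  have hc := hχ.le_const hε
  rcases le_total y (ε / 4) with h | h
  · rw [hχ.eq_id y hy h]
    have : 1 ≤ 4 * c / ε := by rw [le_div_iff₀ hε]; linarith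
    nlinarith
  · refine (hχ.apply_le_const hε hy).trans ?_
    rw [div_mul_eq_mul_div, le_div_iff₀ hε]
    have := hχ.const_pos hε
    nlinarith

end IsCutoff

variable {h H L c₁ ρ T CE M r c : ℝ} {E : ℝ → R3 → R3} {χ : ℝ → ℝ}

/-- Inside the collar the grazing distance is bounded below by the normal velocity and the
depth. -/
lemma sq_add_le_grazingDist_sq (hb : DomainBounds ξ h H L c₁ ρ) (hξ : IsStrictlyConvexDomain ξ)
    (hCE : 0 < CE) (hE : IsAdmissibleField ξ T CE M E) {s : ℝ} (hs : s ∈ Icc 0 T) {x : R3}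
    (hx : x ∈ dom ξ) (u : R3) :
    inner ℝ u (gradient ξ x) ^ 2 + 2 * c₁ * (CE * -ξ x) ≤ grazingDist ξ E s x u ^ 2 := by
  have hx0 : ξ x < 0 := hx
  have hs' := hE.lt_inner_gradient hb hξ hCE hs (hξ.nearest_spec ⟨x, hx⟩ x).1
  have hh : 0 ≤ hess ξ x u :=
    (mul_nonneg hb.h_pos.le (sq_nonneg _)).trans (hb.hess_ge x (subset_closure hx) u)
  set q := inner ℝ (E s (nearest ξ x)) (gradient ξ (nearest ξ x))
  have h1 : CE * c₁ * -ξ x ≤ q * -ξ x := mul_le_mul_of_nonneg_right hs'.le (by linarith)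
  have h2 : 0 ≤ hess ξ x u * -ξ x := mul_nonneg hh (by linarith)
  have h3 : 0 < CE * c₁ * -ξ x := mul_pos (mul_pos hCE hb.c₁_pos) (by linarith)
  have key : inner ℝ u (gradient ξ x) ^ 2 + 2 * c₁ * (CE * -ξ x)
      ≤ inner ℝ u (gradient ξ x) ^ 2 + ξ x ^ 2 - 2 * hess ξ x u * ξ x - 2 * q * ξ x := by
    linarith [sq_nonneg (ξ x)]
  rw [grazingDist, Real.sq_sqrt]
  · exact key
  · refine le_trans ?_ key
    have := sq_nonneg (inner ℝ u (gradient ξ x))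
    linarith

/-- Counterpart of the lower bound, in the form `f'² + W |f|` that the dynamics propagates. The
constant may depend on `M`, as the choice of threshold absorbs it. -/
lemma grazingDist_sq_le (hb : DomainBounds ξ h H L c₁ ρ) (hξ : IsStrictlyConvexDomain ξ)
    (hE : IsAdmissibleField ξ T CE M E) (hCE : 0 < CE) {s : ℝ}
    (hs : s ∈ Icc 0 T) {x : R3} (hx : x ∈ dom ξ) (u : R3) :
    grazingDist ξ E s x u ^ 2
      ≤ (1 + L + 2 * H + 2 * (max M 0 * L))
        * (fderiv ℝ ξ x u ^ 2 + (‖u‖ ^ 2 + 1) * -ξ x) := by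
  have hx0 : ξ x < 0 := hx
  have hL := hb.L_pos
  have hH := hb.H_pos
  have hM : 0 ≤ max M 0 := le_max_right _ _
  have hpos : 0 ≤ inner ℝ u (gradient ξ x) ^ 2 + ξ x ^ 2 - 2 * hess ξ x u * ξ x
      - 2 * inner ℝ (E s (nearest ξ x)) (gradient ξ (nearest ξ x)) * ξ x := by
    have hs' := hE.lt_inner_gradient hb hξ hCE hs (hξ.nearest_spec ⟨x, hx⟩ x).1
    have hq : 0 ≤ inner ℝ (E s (nearest ξ x)) (gradient ξ (nearest ξ x)) :=
      (mul_pos hCE hb.c₁_pos).le.trans hs'.le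
    have hh : 0 ≤ hess ξ x u :=
      (mul_nonneg hb.h_pos.le (sq_nonneg _)).trans (hb.hess_ge x (subset_closure hx) u)
    have h1 := mul_nonneg hq (neg_nonneg.2 hx0.le)
    have h2 := mul_nonneg hh (neg_nonneg.2 hx0.le)
    linarith [sq_nonneg (ξ x), sq_nonneg (inner ℝ u (gradient ξ x))]
  have hn := frontier_subset_closure (hξ.nearest_spec ⟨x, hx⟩ x).1
  rw [grazingDist, Real.sq_sqrt hpos]
  rw [inner_gradient, inner_gradient]
  have hq : fderiv ℝ ξ (nearest ξ x) (E s (nearest ξ x)) ≤ L * max M 0 :=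
    ((Real.le_norm_self _).trans ((fderiv ℝ ξ _).le_opNorm _)).trans
      (mul_le_mul (hb.norm_fderiv_le _ hn) (hE.norm_le hs hn) (norm_nonneg _) hL.le)
  have hh : hess ξ x u ≤ H * ‖u‖ ^ 2 := by
    refine (Real.le_norm_self _).trans ((ContinuousLinearMap.le_opNorm₂ _ u u).trans ?_)
    have := hb.norm_hess_le x (subset_closure hx)
    rw [mul_assoc, ← sq]
    gcongr
  have hxi : -ξ x ≤ L := (neg_le_abs _).trans (hb.abs_le x (subset_closure hx))
  set F := -ξ x
  have hF : 0 < F := by linarith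
  have e1 : ξ x ^ 2 = F * F := by ring
  have e2 : F * F ≤ L * F := by gcongr
  have e3 := mul_le_mul_of_nonneg_right hh hF.le
  have e4 := mul_le_mul_of_nonneg_right hq hF.le
  have e5 : ξ x = -F := by ring
  rw [e1, e5]
  set K := max M 0 * L
  have hK : 0 ≤ K := mul_nonneg hM hL.le
  have a1 : 0 ≤ (L + 2 * H + 2 * K) * fderiv ℝ ξ x u ^ 2 := by positivity
  have a2 : 0 ≤ (1 + L + 2 * K) * (‖u‖ ^ 2 * F) := by positivity
  have a3 : 0 ≤ (1 + 2 * H) * F := by positivity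
  have e6 : L * max M 0 * F = K * F := by ring
  nlinarith

/-- The direction `G` is existential so that one kernel estimate covers both cases: it is `∇ξ(x)` in
the collar, while outside the kinetic distance is constant and any vector of length `c₁` will do. -/
lemma alpha_pos_and_one_div_rpow_le (hb : DomainBounds ξ h H L c₁ ρ)
    (hξ : IsStrictlyConvexDomain ξ) (hcollar : ∀ y ∈ collar ξ r, |ξ y| ≤ ρ)
    (hε : 0 < collarDepth ξ r) (hχ : IsCutoff (collarDepth ξ r) c χ)
    (hCE : 0 < CE) (hE : IsAdmissibleField ξ T CE M E) {β : ℝ} (hβ : 0 < β) {s : ℝ}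
    (hs : s ∈ Icc 0 T) {x : R3} (hx : x ∈ dom ξ) :
    (∀ u, 0 < alpha ξ r χ c E s x u) ∧
    ∃ G : R3, c₁ ≤ ‖G‖ ∧ ∀ u, 1 / alpha ξ r χ c E s x u ^ β
      ≤ (collarDepth ξ r / 4) ^ (-β)
        + (inner ℝ u G ^ 2 + 2 * c₁ * (CE * -ξ x)) ^ (-β / 2) := by
  have hx0 : 0 < -ξ x := neg_pos.2 hx
  have hc₁ := hb.c₁_pos
  set ε := collarDepth ξ r
  have hbp : 0 < 2 * c₁ * (CE * -ξ x) := by positivity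
  by_cases hxc : x ∈ collar ξ r
  · have hg : ∀ u, 0 < grazingDist ξ E s x u := fun u => by
      have h1 := sq_add_le_grazingDist_sq hb hξ hCE hE hs hx u
      have h2 : 0 < grazingDist ξ E s x u ^ 2 := by
        have := sq_nonneg (inner ℝ u (gradient ξ x))
        linarith
      exact lt_of_le_of_ne (Real.sqrt_nonneg _) fun e => by
        rw [← e] at h2; norm_num at h2
    have hmin : ∀ u, min (grazingDist ξ E s x u) (ε / 4) ≤ alpha ξ r χ c E s x u := fun u => by
      rw [alpha, if_pos hxc]
      exact hχ.min_le_apply hε (hg u).le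
    refine ⟨fun u => (lt_min (hg u) (by positivity)).trans_le (hmin u), gradient ξ x,
      hb.le_norm_gradient x (subset_closure hx) (hcollar x hxc), fun u => ?_⟩
    have hpos : 0 < min (grazingDist ξ E s x u) (ε / 4) := lt_min (hg u) (by positivity)
    have hn1 : 0 ≤ (ε / 4) ^ (-β) := by positivity
    have hn2 : 0 ≤ (inner ℝ u (gradient ξ x) ^ 2 + 2 * c₁ * (CE * -ξ x)) ^ (-β / 2) := by
      positivity
    rw [one_div, ← Real.rpow_neg (hpos.le.trans (hmin u))]
    refine (Real.rpow_le_rpow_of_nonpos hpos (hmin u) (by linarith)).trans ?_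
    rcases min_cases (grazingDist ξ E s x u) (ε / 4) with h' | h'
    · rw [h'.1]
      have : grazingDist ξ E s x u ^ (-β) = (grazingDist ξ E s x u ^ 2) ^ (-β / 2) := by
        rw [← Real.rpow_natCast, ← Real.rpow_mul (hg u).le]
        congr 1; push_cast; ring
      rw [this]
      have := Real.rpow_le_rpow_of_nonpos (z := -β / 2)
        (by have := sq_nonneg (inner ℝ u (gradient ξ x)); linarith)
        (sq_add_le_grazingDist_sq hb hξ hCE hE hs hx u) (by linarith)
      linarith
    · rw [h'.1]; linarith
  · have hα : ∀ u, alpha ξ r χ c E s x u = c := fun u => by rw [alpha, if_neg hxc]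
    refine ⟨fun u => by rw [hα]; exact hχ.const_pos hε, EuclideanSpace.single 0 c₁,
      by simp [abs_of_pos hc₁], fun u => ?_⟩
    rw [hα, one_div, ← Real.rpow_neg (hχ.const_pos hε).le]
    have := Real.rpow_le_rpow_of_nonpos (by positivity) (hχ.le_const hε) (by linarith : -β ≤ 0)
    have : 0 ≤ (inner ℝ u (EuclideanSpace.single 0 c₁ : R3) ^ 2
      + 2 * c₁ * (CE * -ξ x)) ^ (-β / 2) := by positivity
    linarith

lemma alpha_le_const (hε : 0 < collarDepth ξ r) (hχ : IsCutoff (collarDepth ξ r) c χ) (s : ℝ)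
    (x u : R3) : alpha ξ r χ c E s x u ≤ c := by
  rw [alpha]
  split_ifs
  · exact hχ.apply_le_const hε (Real.sqrt_nonneg _)
  · exact le_rfl

/-- In the collar the cutoff is at most linear; outside it the depth is bounded below by
compactness, which dominates the constant `c`. -/
lemma exists_alpha_sq_le (hb : DomainBounds ξ h H L c₁ ρ)
    (hξ : IsStrictlyConvexDomain ξ) (hr : 0 < r)
    (hε : 0 < collarDepth ξ r) (hχ : IsCutoff (collarDepth ξ r) c χ)
    (hCE : 0 < CE) (M : ℝ) :
    ∃ C : ℝ, 0 < C ∧ ∀ T E, IsAdmissibleField ξ T CE M E → ∀ s ∈ Icc 0 T, ∀ x ∈ dom ξ, ∀ u,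
      alpha ξ r χ c E s x u ^ 2
        ≤ C * (fderiv ℝ ξ x u ^ 2 + (‖u‖ ^ 2 + 1) * -ξ x) := by
  obtain ⟨η, hη, hdist⟩ := hξ.exists_infDist_lt hr
  have hL := hb.L_pos
  have hH := hb.H_pos
  have hM : 0 ≤ max M 0 := le_max_right _ _
  set K := 1 + L + 2 * H + 2 * (max M 0 * L) with hK
  have hK0 : 0 < K := by positivity
  have hc := hχ.const_pos hε
  set ε := collarDepth ξ r
  refine ⟨(4 * c / ε) ^ 2 * K + c ^ 2 / η, by positivity, fun T E hE s hs x hx u => ?_⟩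
  have hx0 : 0 < -ξ x := neg_pos.2 hx
  set Q := fderiv ℝ ξ x u ^ 2 + (‖u‖ ^ 2 + 1) * -ξ x with hQ
  have hQ0 : 0 ≤ Q := by positivity
  rw [add_mul]
  by_cases hxc : x ∈ collar ξ r
  · have h1 := hχ.apply_le_mul hε (Real.sqrt_nonneg _ : 0 ≤ grazingDist ξ E s x u)
    have h0 := hχ.nonneg _ (Real.sqrt_nonneg _ : 0 ≤ grazingDist ξ E s x u)
    rw [alpha, if_pos hxc]
    calc _ ≤ (4 * c / ε * grazingDist ξ E s x u) ^ 2 := pow_le_pow_left₀ h0 h1 2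
      _ = (4 * c / ε) ^ 2 * grazingDist ξ E s x u ^ 2 := by ring
      _ ≤ (4 * c / ε) ^ 2 * (K * Q) := by
          have := grazingDist_sq_le hb hξ hE hCE hs hx u
          gcongr
      _ ≤ _ := by
          have : 0 ≤ c ^ 2 / η * Q := by positivity
          linarith
  · have hge : η ≤ -ξ x := by
      by_contra! hlt
      exact hxc ⟨hx, hdist x (subset_closure hx)
        (by rw [abs_of_neg (neg_pos.1 hx0)]; exact hlt)⟩
    rw [alpha, if_neg hxc]
    have : η ≤ Q := by
      rw [hQ]
      have : 0 ≤ ‖u‖ ^ 2 * -ξ x := by positivity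
      linarith [sq_nonneg (fderiv ℝ ξ x u)]
    have h2 : c ^ 2 / η * η ≤ c ^ 2 / η * Q := by gcongr
    have h3 : c ^ 2 / η * η = c ^ 2 := by field_simp
    have : 0 ≤ (4 * c / ε) ^ 2 * K * Q := by positivity
    linarith

end KineticDomain

/-! ### The time integral -/

lemma lintegral_indicator_mul_rpow {γ q θ : ℝ} (hγ : γ < 1) (hq : 0 < q) (hθ : 0 < θ) :
    ∫⁻ y : ℝ, ENNReal.ofReal ((Ioc 0 (θ / q)).indicator (fun y => (q * y) ^ (-γ)) y)
      = ENNReal.ofReal (θ ^ (1 - γ) / (q * (1 - γ))) := by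
  have hd : 0 < θ / q := by positivity
  have heq : EqOn (fun y => (q * y) ^ (-γ)) (fun y => q ^ (-γ) * y ^ (-γ)) (Ioc 0 (θ / q)) :=
    fun y hy => Real.mul_rpow hq.le hy.1.le
  have hint : IntegrableOn (fun y : ℝ => y ^ (-γ)) (Ioc 0 (θ / q)) :=
    (intervalIntegral.intervalIntegrable_rpow' (by linarith : -1 < -γ)).1
  have hint' : IntegrableOn (fun y => (q * y) ^ (-γ)) (Ioc 0 (θ / q)) :=
    (IntegrableOn.congr_fun (hint.const_mul _) heq.symm measurableSet_Ioc)
  rw [← ofReal_integral_eq_lintegral_ofReal (hint'.integrable_indicator measurableSet_Ioc)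
    (ae_of_all _ fun y => indicator_nonneg (fun y hy => by
      have := hy.1; positivity) y), integral_indicator measurableSet_Ioc,
    setIntegral_congr_fun measurableSet_Ioc heq, integral_const_mul,
    ← intervalIntegral.integral_of_le hd.le, integral_rpow (Or.inl (by linarith)),
    Real.zero_rpow (by linarith), sub_zero, Real.div_rpow hθ.le hq.le]
  congr 1
  have h1 : -γ + 1 = 1 - γ := by ring
  have h2 : q ^ (1 - γ) = q * q ^ (-γ) := by
    rw [sub_eq_add_neg, Real.rpow_add hq, Real.rpow_one]
  rw [h1, h2]
  have h3 : 0 < q ^ (-γ) := by positivity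
  have h4 : 1 - γ ≠ 0 := by linarith
  field_simp

lemma lintegral_indicator_exp_neg {ν : ℝ} (hν : 0 < ν) :
    ∫⁻ y : ℝ, ENNReal.ofReal ((Ioi 0).indicator (fun y => Real.exp (-ν * y)) y)
      = ENNReal.ofReal ν⁻¹ := by
  rw [← ofReal_integral_eq_lintegral_ofReal
    ((integrableOn_exp_mul_Ioi (by linarith : -ν < 0) 0).integrable_indicator measurableSet_Ioi)
    (ae_of_all _ fun y => indicator_nonneg (fun y _ => (Real.exp_pos _).le) y),
    integral_indicator measurableSet_Ioi, integral_exp_mul_Ioi (by linarith)]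
  congr 1
  simp [neg_div_neg_eq]

/-- Time integration: the singular weight is cut at the level `θ`, below which the depth grows
linearly from one of the ends of the interval. -/
lemma lintegral_exp_mul_rpow_le {a b γ q θ ν A B : ℝ} {φ : ℝ → ℝ} (hγ : 0 < γ) (hγ' : γ < 1)
    (hq : 0 < q) (hθ : 0 < θ) (hν : 0 < ν) (hA : 0 ≤ A) (hB : 0 ≤ B)
    (hφ : ∀ s ∈ Ioo a b, 0 < φ s)
    (hlin : ∀ s ∈ Ioo a b, φ s ≤ θ → q * (s - a) ≤ φ s ∨ q * (b - s) ≤ φ s) :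
    ∫⁻ s in Ioo a b, ENNReal.ofReal (Real.exp (-(ν * (b - s))) * (A + B * φ s ^ (-γ)))
      ≤ ENNReal.ofReal ((A + B * θ ^ (-γ)) * ν⁻¹ + 2 * (B * (θ ^ (1 - γ) / (q * (1 - γ))))) := by
  set ψ : ℝ → ℝ := (Ioc 0 (θ / q)).indicator (fun y => (q * y) ^ (-γ)) with hψ
  set e : ℝ → ℝ := (Ioi 0).indicator (fun y => Real.exp (-ν * y)) with he
  have hψ0 : ∀ y, 0 ≤ ψ y := fun y => indicator_nonneg (fun y hy => by
    have := hy.1; positivity) y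
  have he0 : ∀ y, 0 ≤ e y := fun y => indicator_nonneg (fun y _ => (Real.exp_pos _).le) y
  have hψm : Measurable ψ := by
    apply Measurable.indicator _ measurableSet_Ioc; fun_prop
  have hem : Measurable e := by
    apply Measurable.indicator _ measurableSet_Ioi; fun_prop
  have hA' : 0 ≤ A + B * θ ^ (-γ) := by positivity
  have hJ : 0 ≤ θ ^ (1 - γ) / (q * (1 - γ)) := by
    have : 0 < 1 - γ := by linarith
    positivity
  -- The majorant is built from translates and reflections of fixed functions on the line, so its
  -- integral does not depend on the length of the interval. The linear bounds keep `s - a` or `b -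
  -- s` below `θ / q` whenever `φ s ≤ θ`.
  have hpt : ∀ s ∈ Ioo a b, Real.exp (-(ν * (b - s))) * (A + B * φ s ^ (-γ))
      ≤ (A + B * θ ^ (-γ)) * e (b - s) + (B * ψ (s - a) + B * ψ (b - s)) := by
    intro s hs
    have hes : e (b - s) = Real.exp (-(ν * (b - s))) := by
      rw [he, indicator_of_mem (mem_Ioi.2 (by linarith [hs.2])), neg_mul]
    have hle1 : Real.exp (-(ν * (b - s))) ≤ 1 := Real.exp_le_one_iff.2 (by
      have := mul_pos hν (sub_pos.2 hs.2); linarith)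
    have hφs := hφ s hs
    rw [hes]
    set x := Real.exp (-(ν * (b - s)))
    have hx : 0 ≤ x := (Real.exp_pos _).le
    have h1 := hψ0 (s - a)
    have h2 := hψ0 (b - s)
    have main : φ s ^ (-γ) ≤ θ ^ (-γ) ∨ φ s ^ (-γ) ≤ ψ (s - a) ∨ φ s ^ (-γ) ≤ ψ (b - s) := by
      rcases le_total θ (φ s) with h | h
      · exact Or.inl (Real.rpow_le_rpow_of_nonpos hθ h (by linarith))
      · right
        refine (hlin s hs h).imp (fun h' => ?_) (fun h' => ?_)
        · have hp : 0 < s - a := sub_pos.2 hs.1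
          have hm : s - a ∈ Ioc 0 (θ / q) := ⟨hp, by rw [le_div_iff₀ hq]; linarith⟩
          rw [hψ, indicator_of_mem hm]
          exact Real.rpow_le_rpow_of_nonpos (by positivity) h' (by linarith)
        · have hp : 0 < b - s := sub_pos.2 hs.2
          have hm : b - s ∈ Ioc 0 (θ / q) := ⟨hp, by rw [le_div_iff₀ hq]; linarith⟩
          rw [hψ, indicator_of_mem hm]
          exact Real.rpow_le_rpow_of_nonpos (by positivity) h' (by linarith)
    have hBψ1 : 0 ≤ B * ψ (s - a) := by positivity
    have hBψ2 : 0 ≤ B * ψ (b - s) := by positivity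
    have hBφ : 0 ≤ B * φ s ^ (-γ) := by positivity
    have hBθ : 0 ≤ x * (B * θ ^ (-γ)) := by positivity
    have hxB : x * (B * φ s ^ (-γ)) ≤ B * φ s ^ (-γ) := mul_le_of_le_one_left hBφ hle1
    rw [mul_add, add_mul, mul_comm A x, mul_comm (B * θ ^ (-γ)) x]
    rcases main with h | h | h
    · have := mul_le_mul_of_nonneg_left (mul_le_mul_of_nonneg_left h hB) hx
      linarith
    · have := mul_le_mul_of_nonneg_left h hB
      linarith
    · have := mul_le_mul_of_nonneg_left h hB
      linarith
  have hψJ := lintegral_indicator_mul_rpow hγ' hq hθ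
  rw [← hψ] at hψJ
  have heJ := lintegral_indicator_exp_neg hν
  rw [← he] at heJ
  calc _ ≤ ∫⁻ s in Ioo a b, (ENNReal.ofReal (A + B * θ ^ (-γ)) * ENNReal.ofReal (e (b - s))
        + (ENNReal.ofReal B * ENNReal.ofReal (ψ (s - a))
          + ENNReal.ofReal B * ENNReal.ofReal (ψ (b - s)))) := by
        refine setLIntegral_mono' measurableSet_Ioo fun s hs => ?_
        have h0 := he0 (b - s)
        have h1 := hψ0 (s - a)
        have h2 := hψ0 (b - s)
        rw [← ENNReal.ofReal_mul hA', ← ENNReal.ofReal_mul hB, ← ENNReal.ofReal_mul hB,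
          ← ENNReal.ofReal_add (by positivity) (by positivity),
          ← ENNReal.ofReal_add (by positivity) (by positivity)]
        exact ENNReal.ofReal_le_ofReal (hpt s hs)
    _ ≤ ∫⁻ s, (ENNReal.ofReal (A + B * θ ^ (-γ)) * ENNReal.ofReal (e (b - s))
        + (ENNReal.ofReal B * ENNReal.ofReal (ψ (s - a))
          + ENNReal.ofReal B * ENNReal.ofReal (ψ (b - s)))) := setLIntegral_le_lintegral _ _
    _ = _ := by
        rw [lintegral_add_left (by fun_prop), lintegral_add_left (by fun_prop),
          lintegral_const_mul _ (by fun_prop), lintegral_const_mul _ (by fun_prop),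
          lintegral_const_mul _ (by fun_prop),
          lintegral_sub_left_eq_self (fun y => ENNReal.ofReal (e y)) b,
          lintegral_sub_left_eq_self (fun y => ENNReal.ofReal (ψ y)) b,
          lintegral_sub_right_eq_self (fun y => ENNReal.ofReal (ψ y)) a, hψJ, heJ,
          ← ENNReal.ofReal_mul hA', ← ENNReal.ofReal_mul hB,
          ← ENNReal.ofReal_add (by positivity) (by positivity),
          ← ENNReal.ofReal_add (by positivity) (by positivity), two_mul]

/-! ### Characteristics and linear growth of the depth -/

namespace KineticDomain

variable {ξ : R3 → ℝ}

lemma startTime_nonneg (ξ : R3 → ℝ) (X : ℝ → R3) (t : ℝ) : 0 ≤ startTime ξ X t :=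
  EReal.toReal_nonneg (le_max_left _ _)

lemma mem_dom_of_startTime_lt {X : ℝ → R3} {t τ : ℝ} (h1 : startTime ξ X t < τ) (h2 : τ < t) :
    X τ ∈ dom ξ := by
  have h0 : 0 ≤ exitTime ξ X t := le_sSup ⟨0, ⟨le_rfl, by simp⟩, rfl⟩
  have hlt : ((t - τ : ℝ) : EReal) < exitTime ξ X t := by
    by_contra! hle
    have h3 : (τ : EReal) ≤ (t : EReal) - exitTime ξ X t := by
      have := EReal.sub_le_sub (le_refl (t : EReal)) hle
      rw [← EReal.coe_sub, sub_sub_cancel] at this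
      exact this
    have h4 : (t : EReal) - exitTime ξ X t ≤ t := by
      have := EReal.sub_le_sub (le_refl (t : EReal)) h0
      rwa [sub_zero] at this
    have h5 : max 0 ((t : EReal) - exitTime ξ X t) ≠ ⊤ :=
      ((max_le_max le_rfl h4).trans_lt (max_lt EReal.zero_lt_top (EReal.coe_lt_top t))).ne
    have := EReal.toReal_le_toReal (h3.trans (le_max_right 0 _)) (EReal.coe_ne_bot τ) h5
    rw [EReal.toReal_coe] at this
    exact absurd this (not_le.2 h1)
  obtain ⟨_, ⟨s, hs, rfl⟩, hs'⟩ := lt_sSup_iff.1 hlt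
  exact hs.2 τ ⟨by linarith [EReal.coe_lt_coe_iff.1 hs'], h2⟩

namespace IsBackwardCharacteristic

variable {E : ℝ → R3 → R3} {t : ℝ} {x v : R3} {X V : ℝ → R3}

lemma continuousOn_pos (hX : IsBackwardCharacteristic ξ E t x v X V)
    : ContinuousOn X (Icc (startTime ξ X t) t) :=
  fun s hs => (hX.deriv_pos s hs).continuousWithinAt

lemma continuousOn_vel (hX : IsBackwardCharacteristic ξ E t x v X V)
    : ContinuousOn V (Icc (startTime ξ X t) t) :=
  fun s hs => (hX.deriv_vel s hs).continuousWithinAt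

lemma mem_closure (hX : IsBackwardCharacteristic ξ E t x v X V)
    (ha : startTime ξ X t < t) {s : ℝ} (hs : s ∈ Icc (startTime ξ X t) t) :
    X s ∈ closure (dom ξ) := by
  have hc := hX.continuousOn_pos
  rw [← closure_Ioo ha.ne] at hc hs
  refine closure_mono ?_ (hc.image_closure ⟨s, hs, rfl⟩)
  rintro _ ⟨τ, hτ, rfl⟩
  exact mem_dom_of_startTime_lt hτ.1 hτ.2

/-- Allows the weight `|V|² + 1` to be frozen at `W = |v|² + 1` along the whole trajectory. -/
lemma norm_vel_sub_le (hX : IsBackwardCharacteristic ξ E t x v X V)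
    {T CE M : ℝ} (hE : IsAdmissibleField ξ T CE M E) (ht : t ≤ T)
    (ha : startTime ξ X t < t) {s : ℝ} (hs : s ∈ Icc (startTime ξ X t) t) :
    ‖V s - v‖ ≤ max M 0 * T := by
  have h0 := startTime_nonneg ξ X t
  have := (convex_Icc (startTime ξ X t) t).norm_image_sub_le_of_norm_hasDerivWithin_le
    hX.deriv_vel (fun τ hτ => hE.norm_le ⟨h0.trans hτ.1, hτ.2.trans ht⟩ (hX.mem_closure ha hτ))
    (right_mem_Icc.2 ha.le) hs
  rw [hX.vel] at this
  refine this.trans (mul_le_mul_of_nonneg_left ?_ (le_max_right _ _))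
  rw [Real.norm_eq_abs, abs_le]
  constructor <;> linarith [hs.1, hs.2]

lemma hasDerivWithinAt_depth (hX : IsBackwardCharacteristic ξ E t x v X V)
    (hξ : IsStrictlyConvexDomain ξ) {s : ℝ}
    (hs : s ∈ Icc (startTime ξ X t) t) :
    HasDerivWithinAt (fun τ => ξ (X τ)) (fderiv ℝ ξ (X s) (V s)) (Icc (startTime ξ X t) t) s :=
  ((hξ.contDiff.differentiable (by norm_num)) (X s)).hasFDerivAt.comp_hasDerivWithinAt s
    (hX.deriv_pos s hs)

lemma hasDerivWithinAt_normal_vel (hX : IsBackwardCharacteristic ξ E t x v X V)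
    (hξ : IsStrictlyConvexDomain ξ) {s : ℝ}
    (hs : s ∈ Icc (startTime ξ X t) t) :
    HasDerivWithinAt (fun τ => fderiv ℝ ξ (X τ) (V τ))
      (hess ξ (X s) (V s) + fderiv ℝ ξ (X s) (E s (X s))) (Icc (startTime ξ X t) t) s :=
  (((hξ.contDiff_fderiv.differentiable (by norm_num)) (X s)).hasFDerivAt.comp_hasDerivWithinAt s
    (hX.deriv_pos s hs)).clm_apply (hX.deriv_vel s hs)

end IsBackwardCharacteristic

variable {h H L c₁ ρ T CE M r c : ℝ} {χ : ℝ → ℝ}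

/-- Near the boundary the depth grows linearly away from the ends of the trajectory, at a rate
proportional to the kinetic distance of the final point. -/
lemma exists_linear_growth (hb : DomainBounds ξ h H L c₁ ρ)
    (hξ : IsStrictlyConvexDomain ξ) (hr : 0 < r)
    (hε : 0 < collarDepth ξ r) (hχ : IsCutoff (collarDepth ξ r) c χ)
    (hCE : 0 < CE) (M : ℝ) (hT : 0 < T) :
    ∃ κ₀ D : ℝ, 0 < κ₀ ∧ 0 < D ∧ ∀ E, IsAdmissibleField ξ T CE M E → ∀ t ∈ Icc 0 T,
      ∀ x ∈ dom ξ, ∀ v X V, IsBackwardCharacteristic ξ E t x v X V → startTime ξ X t < t →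
      0 < alpha ξ r χ c E t x v →
      ∀ θ, D * ((‖v‖ ^ 2 + 1) * θ) ≤ alpha ξ r χ c E t x v ^ 2 / 2 →
      ∀ s ∈ Icc (startTime ξ X t) t, -θ ≤ ξ (X s) →
        κ₀ * alpha ξ r χ c E t x v * (s - startTime ξ X t) ≤ -ξ (X s) ∨
        κ₀ * alpha ξ r χ c E t x v * (t - s) ≤ -ξ (X s) := by
  have hh := hb.h_pos
  have hH := hb.H_pos
  have hL := hb.L_pos
  have hc₁ := hb.c₁_pos
  obtain ⟨η, hη, hsign⟩ := exists_le_fderiv_apply hb hξ hCE M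
  obtain ⟨C', hC', hα'⟩ := exists_alpha_sq_le hb hξ hr hε hχ hCE M
  have hM : 0 ≤ max M 0 := le_max_right _ _
  set M' := max M 0
  set B := M' * T with hB
  have hB0 : 0 ≤ B := by positivity
  -- From `W ≤ 2|V|² + (2B² + 1)`: the Hessian pays for the first summand, the sign condition for
  -- the second.
  set κ₁ := min (h / 2) (CE * c₁ / 2 / (2 * B ^ 2 + 1)) with hκ₁
  have hκ₁0 : 0 < κ₁ := lt_min (by positivity) (by positivity)
  set κ₂ := 2 * H + 2 * H * B ^ 2 + L * M' + 1 with hκ₂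
  obtain ⟨D, hD, hdyn⟩ := exists_sq_le_sq_add (κ₁ := κ₁) (κ₂ := κ₂) (η := η / 2) (C' := C')
    (c := c) hκ₁0 (by positivity) (by positivity) hC'
  refine ⟨1 / √(2 * D) / 2, D, by positivity, hD, ?_⟩
  intro E hE t ht x hx v X V hX ha hα θ hθ s hs hsθ
  have h0 := startTime_nonneg ξ X t
  set a := startTime ξ X t with ha'
  set α := alpha ξ r χ c E t x v
  have hW : 1 ≤ ‖v‖ ^ 2 + 1 := by linarith [sq_nonneg ‖v‖]
  have hcl : ∀ τ ∈ Icc a t, X τ ∈ closure (dom ξ) := fun τ hτ => hX.mem_closure ha hτ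
  have hmem : ∀ τ ∈ Icc a t, τ ∈ Icc 0 T := fun τ hτ => ⟨h0.trans hτ.1, hτ.2.trans ht.2⟩
  have hV : ∀ τ ∈ Icc a t, ‖V τ - v‖ ≤ B := fun τ hτ => hX.norm_vel_sub_le hE ht.2 ha hτ
  have hneg : ∀ τ ∈ Icc a t, ξ (X τ) ≤ 0 := fun τ hτ => hξ.nonpos (hcl τ hτ)
  have hlow : ∀ τ ∈ Icc a t, -(η / 2) ≤ ξ (X τ) →
      κ₁ * (‖v‖ ^ 2 + 1) ≤ hess ξ (X τ) (V τ) + fderiv ℝ ξ (X τ) (E τ (X τ)) := by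
    intro τ hτ hnear
    have e1 := hb.hess_ge (X τ) (hcl τ hτ) (V τ)
    have e2 := hsign T E hE τ (hmem τ hτ) (X τ) (hcl τ hτ) (by
      rw [abs_of_nonpos (hneg τ hτ)]; linarith)
    have e3 : ‖v‖ ≤ ‖V τ‖ + B := by
      have := norm_sub_norm_le v (V τ)
      rw [norm_sub_rev] at this
      linarith [hV τ hτ]
    have e4 : ‖v‖ ^ 2 + 1 ≤ 2 * ‖V τ‖ ^ 2 + (2 * B ^ 2 + 1) := by
      have := pow_le_pow_left₀ (norm_nonneg v) e3 2
      nlinarith [sq_nonneg (‖V τ‖ - B)]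
    have e5 : κ₁ * (2 * ‖V τ‖ ^ 2) ≤ h * ‖V τ‖ ^ 2 := by
      have : κ₁ ≤ h / 2 := min_le_left _ _
      nlinarith [mul_le_mul_of_nonneg_right this (sq_nonneg ‖V τ‖)]
    have e6 : κ₁ * (2 * B ^ 2 + 1) ≤ CE * c₁ / 2 := by
      rw [← le_div_iff₀ (by positivity)]; exact min_le_right _ _
    have e7 := mul_le_mul_of_nonneg_left e4 hκ₁0.le
    rw [mul_add κ₁ (2 * _)] at e7
    linarith
  have hup : ∀ τ ∈ Icc a t,
      hess ξ (X τ) (V τ) + fderiv ℝ ξ (X τ) (E τ (X τ)) ≤ κ₂ * (‖v‖ ^ 2 + 1) := by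
    intro τ hτ
    have e1 : hess ξ (X τ) (V τ) ≤ H * ‖V τ‖ ^ 2 := by
      refine (Real.le_norm_self _).trans ((ContinuousLinearMap.le_opNorm₂ _ _ _).trans ?_)
      have := hb.norm_hess_le (X τ) (hcl τ hτ)
      rw [mul_assoc, ← sq]
      gcongr
    have e2 : fderiv ℝ ξ (X τ) (E τ (X τ)) ≤ L * M' :=
      ((Real.le_norm_self _).trans ((fderiv ℝ ξ _).le_opNorm _)).trans
        (mul_le_mul (hb.norm_fderiv_le _ (hcl τ hτ)) (hE.norm_le (hmem τ hτ) (hcl τ hτ))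
          (norm_nonneg _) hL.le)
    have e3 : ‖V τ‖ ≤ ‖v‖ + B := by
      have := norm_sub_norm_le (V τ) v
      linarith [hV τ hτ]
    have e4 : ‖V τ‖ ^ 2 ≤ 2 * ‖v‖ ^ 2 + 2 * B ^ 2 := by
      have := pow_le_pow_left₀ (norm_nonneg (V τ)) e3 2
      nlinarith [sq_nonneg (‖v‖ - B)]
    have e5 := mul_le_mul_of_nonneg_left e4 hH.le
    have a1 : 0 ≤ (2 * H * B ^ 2 + L * M' + 1) * ‖v‖ ^ 2 := by positivity
    rw [hκ₂]
    nlinarith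
  have hgr := hdyn (‖v‖ ^ 2 + 1) α a t (fun τ => ξ (X τ)) (fun τ => fderiv ℝ ξ (X τ) (V τ))
    (fun τ => hess ξ (X τ) (V τ) + fderiv ℝ ξ (X τ) (E τ (X τ))) hW
    (fun τ hτ => hX.hasDerivWithinAt_depth hξ hτ)
    (fun τ hτ => hX.hasDerivWithinAt_normal_vel hξ hτ) hneg hlow hup hα.le
    (alpha_le_const hε hχ t x v) (by
      simp only [hX.pos, hX.vel]
      exact hα' T E hE t ht x hx v)
  -- At depth at most `θ` the term `W|f|` accounts for at most half of `α ^ 2`, so the slope must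
  -- account for the other half.
  have hsteep : ∀ τ ∈ Icc a t, -θ ≤ ξ (X τ) →
      1 / √(2 * D) * α ≤ |fderiv ℝ ξ (X τ) (V τ)| := by
    intro τ hτ hnear
    have e1 := hgr τ hτ
    have e2 : D * ((‖v‖ ^ 2 + 1) * -ξ (X τ)) ≤ D * ((‖v‖ ^ 2 + 1) * θ) := by
      gcongr; linarith
    apply abs_le_of_sq_le_sq' _ (abs_nonneg _) |>.2
    rw [sq_abs, mul_pow, div_pow, Real.sq_sqrt (by positivity), one_pow, one_div_mul_eq_div,
      div_le_iff₀ (by positivity)]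
    linarith
  have := mul_sub_le_neg_or (by positivity) (fun τ hτ => hX.hasDerivWithinAt_depth hξ hτ)
    (fun τ hτ => (hX.hasDerivWithinAt_normal_vel hξ hτ).continuousWithinAt) hneg hsteep hs hsθ
  have e : 1 / √(2 * D) / 2 * α = 1 / √(2 * D) * α / 2 := by ring
  rw [e]
  exact this

end KineticDomain

/-! ### Choice of the depth threshold -/

/-- The powers of `α` match because `2 · (3 - β) / 2 - 1 = 2 - β`. The factor `μ` cancels both the
growth rate `κ₀` and the cost `N` of replacing `W` by `S`, so no constant remains. -/
lemma rpow_div_le_of_threshold {β δ α κ₀ μ N W S : ℝ} (hβ : β < 3) (hδ : 0 < δ) (hα : 0 < α)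
    (hκ₀ : 0 < κ₀) (hμ : 0 < μ) (hN : 0 < N) (hW : 0 < W) (hS : 0 < S) (hSN : S ≤ N * W)
    (hμκ : μ ^ ((3 - β) / 2) ≤ κ₀ / N ^ ((3 - β) / 2)) :
    (μ * δ * α ^ 2 / W) ^ ((3 - β) / 2) / (κ₀ * α)
      ≤ δ ^ ((3 - β) / 2) / (α ^ (β - 2) * S ^ ((3 - β) / 2)) := by
  set e := (3 - β) / 2 with he
  have he0 : 0 < e := by rw [he]; linarith
  have h1 : (μ * δ * α ^ 2 / W) ^ e = μ ^ e * δ ^ e * (α / α ^ (β - 2)) / W ^ e := by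
    rw [Real.div_rpow (by positivity) hW.le, Real.mul_rpow (by positivity) (by positivity),
      Real.mul_rpow hμ.le hδ.le, ← Real.rpow_natCast, ← Real.rpow_mul hα.le]
    congr 2
    rw [show ((2 : ℕ) : ℝ) * e = 1 - (β - 2) by rw [he]; push_cast; ring, Real.rpow_sub hα,
      Real.rpow_one]
  have h2 : S ^ e ≤ N ^ e * W ^ e := by
    rw [← Real.mul_rpow hN.le hW.le]
    exact Real.rpow_le_rpow hS.le hSN he0.le
  have hNe : 0 < N ^ e := by positivity
  have hWe : 0 < W ^ e := by positivity
  have hSe : 0 < S ^ e := by positivity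
  have hαe : 0 < α ^ (β - 2) := by positivity
  have hδe : 0 < δ ^ e := by positivity
  rw [h1]
  calc μ ^ e * δ ^ e * (α / α ^ (β - 2)) / W ^ e / (κ₀ * α)
      ≤ κ₀ / N ^ e * δ ^ e * (α / α ^ (β - 2)) / W ^ e / (κ₀ * α) := by gcongr
    _ = δ ^ e / (α ^ (β - 2) * (N ^ e * W ^ e)) := by field_simp
    _ ≤ _ := by gcongr

/-- Here `μ` is traded for `CE * δ`: the product inside then dominates a square, and the exponent
doubles. -/
lemma rpow_neg_le_of_threshold {β δ α CE μ W Y : ℝ} (hβ : 1 < β) (hδ : 0 < δ) (hα : 0 < α)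
    (hCE : 0 < CE) (hμ : CE * δ ≤ μ) (hW : 0 < W) (hY : 0 < Y) (hWY : W ≤ Y ^ 2) :
    (CE * (μ * δ * α ^ 2 / W)) ^ (-((β - 1) / 2)) ≤ (CE * δ * α / Y) ^ (-(β - 1)) := by
  have hμ0 : 0 < μ := (mul_pos hCE hδ).trans_le hμ
  have h : (CE * δ * α / Y) ^ 2 ≤ CE * (μ * δ * α ^ 2 / W) := by
    calc (CE * δ * α / Y) ^ 2 = CE * ((CE * δ) * δ * α ^ 2 / Y ^ 2) := by ring
      _ ≤ _ := by gcongr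
  refine (Real.rpow_le_rpow_of_nonpos (by positivity) h (by linarith)).trans_eq ?_
  rw [← Real.rpow_natCast, ← Real.rpow_mul (by positivity)]
  congr 1; push_cast; ring

/-- Choice of the threshold: the slack between `δ^{-(β-1)}` and `δ^{-(β-1)/2}` absorbs all constants
for small `δ`. -/
lemma exists_threshold {β CE κ₀ D m c : ℝ} (hβ : 1 < β) (hβ' : β < 3) (hCE : 0 < CE)
    (hκ₀ : 0 < κ₀) (hD : 0 < D) (hM : 0 ≤ m) (hc : 0 < c) :
    ∃ δ₀ : ℝ, 0 < δ₀ ∧ ∀ δ α F y P ϖ : ℝ, 0 < δ → δ < δ₀ → 0 < α → α ≤ c → 0 ≤ F → F ≤ m →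
      0 ≤ y → 1 ≤ P → 0 < ϖ → ∃ θ : ℝ, 0 < θ ∧ D * ((y ^ 2 + 1) * θ) ≤ α ^ 2 / 2 ∧
        (1 + (CE * θ) ^ (-((β - 1) / 2))) * (2 / ϖ)
            + θ ^ ((3 - β) / 2) / (κ₀ * α) / CE ^ ((β - 1) / 2)
          ≤ (1 + c ^ (β - 1)) * (P * (δ ^ ((3 - β) / 2)
                / (CE ^ ((β - 1) / 2) * α ^ (β - 2) * (y ^ 2 + F ^ 2 + F + 1) ^ ((3 - β) / 2)))
              + (y + F + F ^ 2 + 1) ^ (β - 1) / (CE ^ (β - 1) * δ ^ (β - 1) * α ^ (β - 1))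
                * (2 / ϖ)) := by
  set N := 1 + m + m ^ 2 with hN
  have hN1 : 1 ≤ N := by rw [hN]; nlinarith
  set e := (3 - β) / 2 with he
  have he0 : 0 < e := by rw [he]; linarith
  set μ := min 1 ((κ₀ / N ^ e) ^ e⁻¹) with hμ
  have hμ0 : 0 < μ := lt_min one_pos (by positivity)
  have hμκ : μ ^ e ≤ κ₀ / N ^ e := by
    refine (Real.rpow_le_rpow hμ0.le (min_le_right _ _) he0.le).trans_eq ?_
    exact Real.rpow_inv_rpow (by positivity) he0.ne'
  -- The first bound makes `θ` admissible for the linear growth; the second gives `CE * δ ≤ μ`.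
  refine ⟨min (1 / (2 * D)) (μ / CE), lt_min (by positivity) (by positivity), ?_⟩
  intro δ α F y P ϖ hδ hδ' hα hαc hF0 hF hv hP hϖ0
  set W := y ^ 2 + 1 with hW
  have hW1 : 1 ≤ W := by rw [hW]; linarith [sq_nonneg y]
  have hCEδ : CE * δ ≤ μ := by
    have := hδ'.trans_le (min_le_right _ _)
    rw [lt_div_iff₀ hCE] at this
    linarith
  have hDδ : D * δ ≤ 1 / 2 := by
    have := hδ'.trans_le (min_le_left _ _)
    rw [lt_div_iff₀ (by positivity)] at this
    linarith
  set Y := y + F + F ^ 2 + 1 with hY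
  have hY1 : 1 ≤ Y := by rw [hY]; linarith [sq_nonneg F]
  set S := y ^ 2 + F ^ 2 + F + 1 with hS
  have hS0 : 0 < S := by rw [hS]; positivity
  have hSN : S ≤ N * W := by
    have h1 : F ^ 2 ≤ m ^ 2 := pow_le_pow_left₀ hF0 hF 2
    have h2 : 0 ≤ (m + m ^ 2) * y ^ 2 := by positivity
    rw [hS, hN, hW]
    linarith
  have hWY : W ≤ Y ^ 2 := by
    rw [hW, hY]
    have h1 : 0 ≤ (F + F ^ 2) * (y + F + F ^ 2 + 1) := by positivity
    have h2 : 0 ≤ (y + 1) * (F + F ^ 2) := by positivity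
    nlinarith
  have hθ : 0 < μ * δ * α ^ 2 / W := by positivity
  have hDθ : D * (W * (μ * δ * α ^ 2 / W)) ≤ α ^ 2 / 2 := by
    have e1 : D * (W * (μ * δ * α ^ 2 / W)) = μ * (D * δ) * α ^ 2 := by field_simp
    have e2 : μ * (D * δ) ≤ 1 * (1 / 2) := by
      gcongr
      exact min_le_left _ _
    rw [e1]
    linarith [mul_le_mul_of_nonneg_right e2 (sq_nonneg α)]
  refine ⟨_, hθ, hDθ, ?_⟩
  have hfirst := rpow_div_le_of_threshold hβ' hδ hα hκ₀ hμ0 (by linarith) (by linarith) hS0 hSN hμκ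
  have hsecond := rpow_neg_le_of_threshold hβ hδ hα hCE hCEδ (by linarith) (by linarith) hWY
  have hy : CE * δ * α / Y ≤ c := by
    rw [div_le_iff₀ (by linarith)]
    have : CE * δ ≤ 1 := hCEδ.trans (min_le_left _ _)
    calc CE * δ * α ≤ 1 * c := by gcongr
      _ ≤ c * Y := by nlinarith
  -- The non-singular summand `1` is absorbed into the second term, since `α ≤ c` keeps the base of
  -- the negative power at most `c`.
  have hone : 1 ≤ c ^ (β - 1) * (CE * δ * α / Y) ^ (-(β - 1)) := by
    calc (1 : ℝ) = c ^ (β - 1) * c ^ (-(β - 1)) := by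
          rw [← Real.rpow_add hc, add_neg_cancel, Real.rpow_zero]
      _ ≤ _ := by
          gcongr ?_ * ?_
          exact Real.rpow_le_rpow_of_nonpos (by positivity) hy (by linarith)
  have hsecond_eq : (CE * δ * α / Y) ^ (-(β - 1))
      = Y ^ (β - 1) / (CE ^ (β - 1) * δ ^ (β - 1) * α ^ (β - 1)) := by
    rw [Real.rpow_neg (by positivity), Real.div_rpow (by positivity) (by positivity), inv_div,
      Real.mul_rpow (by positivity) hα.le, Real.mul_rpow hCE.le hδ.le]
  rw [← hsecond_eq]
  set Z := (CE * δ * α / Y) ^ (-(β - 1))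
  have hfirst' : (μ * δ * α ^ 2 / W) ^ e / (κ₀ * α) / CE ^ ((β - 1) / 2)
      ≤ δ ^ e / (CE ^ ((β - 1) / 2) * α ^ (β - 2) * S ^ e) := by
    refine (div_le_div_of_nonneg_right hfirst (by positivity)).trans_eq ?_
    rw [div_div]
    congr 1; ring
  set Q := δ ^ e / (CE ^ ((β - 1) / 2) * α ^ (β - 2) * S ^ e)
  have hQ : 0 ≤ Q := by positivity
  have hcβ : 0 < c ^ (β - 1) := by positivity
  have hZ : 0 < Z := by positivity
  have h1 : (1 + (CE * (μ * δ * α ^ 2 / W)) ^ (-((β - 1) / 2))) * (2 / ϖ)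
      ≤ (1 + c ^ (β - 1)) * Z * (2 / ϖ) := by
    gcongr
    linarith
  have h2 : Q ≤ P * Q := le_mul_of_one_le_left hQ hP
  have h3 : 0 ≤ c ^ (β - 1) * (P * Q) := by positivity
  calc _ ≤ (1 + c ^ (β - 1)) * Z * (2 / ϖ) + Q := add_le_add h1 hfirst'
    _ ≤ (1 + c ^ (β - 1)) * (P * Q + Z * (2 / ϖ)) := by linarith

/-! ### Assembly along a trajectory -/

namespace KineticDomain

variable {ξ : R3 → ℝ} {h H L c₁ ρ T CE M r c : ℝ} {χ : ℝ → ℝ}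

lemma one_le_bracket (v : R3) : 1 ≤ bracket v := by
  rw [bracket, Real.one_le_sqrt]
  linarith [sq_nonneg ‖v‖]

lemma continuous_bracket : Continuous bracket := by
  unfold bracket; fun_prop

lemma exp_neg_integral_bracket_le {V : ℝ → R3} {a s t ϖ : ℝ} (hV : ContinuousOn V (Icc a t))
    (hs : s ∈ Icc a t) (hϖ : 0 ≤ ϖ) :
    Real.exp (-∫ τ in s..t, ϖ / 2 * bracket (V τ)) ≤ Real.exp (-(ϖ / 2 * (t - s))) := by
  refine Real.exp_le_exp.2 (neg_le_neg ?_)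
  have hc : ContinuousOn (fun τ => ϖ / 2 * bracket (V τ)) (uIcc s t) := by
    rw [uIcc_of_le hs.2]
    exact continuousOn_const.mul
      (continuous_bracket.comp_continuousOn (hV.mono (Icc_subset_Icc_left hs.1)))
  calc ϖ / 2 * (t - s) = ∫ _ in s..t, ϖ / 2 := by
        rw [intervalIntegral.integral_const, smul_eq_mul, mul_comm]
    _ ≤ _ := by
        refine intervalIntegral.integral_mono_on hs.2 intervalIntegrable_const
          hc.intervalIntegrable fun τ _ => ?_
        have := one_le_bracket (V τ)
        nlinarith

/-- The velocity integral at a fixed time. -/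
lemma exists_lintegral_velocity_le (hb : DomainBounds ξ h H L c₁ ρ)
    (hξ : IsStrictlyConvexDomain ξ) (hcollar : ∀ y ∈ collar ξ r, |ξ y| ≤ ρ)
    (hε : 0 < collarDepth ξ r) (hχ : IsCutoff (collarDepth ξ r) c χ)
    {β κ Cθ : ℝ} (hβ : 1 < β) (hκ : 0 < κ) (hκ' : κ ≤ 1) (hCθ : 0 < Cθ) :
    ∃ C : ℝ, 0 < C ∧ ∀ T CE M E, 0 < CE → IsAdmissibleField ξ T CE M E → ∀ s ∈ Icc 0 T,
      ∀ x ∈ dom ξ, ∀ (V : R3) (y z : ℝ), 0 ≤ y → y ≤ z →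
      ∫⁻ u : R3, ENNReal.ofReal (y
          * (Real.exp (-(Cθ / 2) * ‖V - u‖ ^ 2) / ‖V - u‖ ^ (2 - κ))
          * (1 / alpha ξ r χ c E s x u ^ β))
        ≤ ENNReal.ofReal (z * (C + C * (CE * -ξ x) ^ (-((β - 1) / 2)))) := by
  have hc₁ := hb.c₁_pos
  obtain ⟨C, hC, hker⟩ := exists_lintegral_kernel_le (A := (collarDepth ξ r / 4) ^ (-β))
    hβ hκ hκ' hCθ (by positivity) hc₁
  refine ⟨C * (1 + (2 * c₁) ^ (-((β - 1) / 2))), by positivity, ?_⟩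
  intro T CE M E hCE hE s hs x hx V y z hy hyz
  have hx0 : 0 < -ξ x := neg_pos.2 hx
  obtain ⟨-, G, hG, hα⟩ := alpha_pos_and_one_div_rpow_le hb hξ hcollar hε hχ hCE hE
    (by linarith : 0 < β) hs hx
  have hbp : 0 < 2 * c₁ * (CE * -ξ x) := by positivity
  calc _ ≤ ∫⁻ u : R3, ENNReal.ofReal y * ENNReal.ofReal
          (Real.exp (-(Cθ / 2) * ‖V - u‖ ^ 2) / ‖V - u‖ ^ (2 - κ)
            * ((collarDepth ξ r / 4) ^ (-β)
              + (inner ℝ u G ^ 2 + 2 * c₁ * (CE * -ξ x)) ^ (-β / 2))) := by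
        refine lintegral_mono fun u => ?_
        rw [← ENNReal.ofReal_mul hy, mul_assoc]
        have := hα u
        exact ENNReal.ofReal_le_ofReal (by gcongr)
    _ = ENNReal.ofReal y * ∫⁻ u : R3, ENNReal.ofReal
          (Real.exp (-(Cθ / 2) * ‖V - u‖ ^ 2) / ‖V - u‖ ^ (2 - κ)
            * ((collarDepth ξ r / 4) ^ (-β)
              + (inner ℝ u G ^ 2 + 2 * c₁ * (CE * -ξ x)) ^ (-β / 2))) :=
        lintegral_const_mul' _ _ ENNReal.ofReal_ne_top
    _ ≤ ENNReal.ofReal y * ENNReal.ofReal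
          (C * (1 + (2 * c₁ * (CE * -ξ x)) ^ (-((β - 1) / 2)))) := by
        gcongr
        exact hker V G _ hG hbp
    _ ≤ _ := by
        rw [← ENNReal.ofReal_mul hy]
        apply ENNReal.ofReal_le_ofReal
        rw [Real.mul_rpow (by positivity) (by positivity)]
        have h1 : 0 < (2 * c₁) ^ (-((β - 1) / 2)) := by positivity
        have h2 : 0 < (CE * -ξ x) ^ (-((β - 1) / 2)) := by positivity
        set p := (2 * c₁) ^ (-((β - 1) / 2))
        set q := (CE * -ξ x) ^ (-((β - 1) / 2))
        refine mul_le_mul hyz ?_ (by positivity) (hy.trans hyz)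
        have e1 : 0 ≤ C * p := by positivity
        have e2 : 0 ≤ C * q := by positivity
        nlinarith

/-- The estimate along a fixed trajectory, before the threshold is expressed through `δ`. -/
lemma exists_lintegral_le (hb : DomainBounds ξ h H L c₁ ρ)
    (hξ : IsStrictlyConvexDomain ξ) (hcollar : ∀ y ∈ collar ξ r, |ξ y| ≤ ρ) (hr : 0 < r)
    (hε : 0 < collarDepth ξ r) (hχ : IsCutoff (collarDepth ξ r) c χ)
    {β κ Cθ : ℝ} (hβ : 1 < β) (hβ' : β < 3) (hκ : 0 < κ) (hκ' : κ ≤ 1) (hCθ : 0 < Cθ)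
    (hT : 0 < T) :
    ∃ C : ℝ, 0 < C ∧ ∀ CE M, 0 < CE → ∃ κ₀ D : ℝ, 0 < κ₀ ∧ 0 < D ∧
      ∀ E, IsAdmissibleField ξ T CE M E → ∀ ϖ, 0 < ϖ → ∀ t ∈ Icc 0 T, ∀ x ∈ dom ξ,
      ∀ v X V, IsBackwardCharacteristic ξ E t x v X V →
      0 < alpha ξ r χ c E t x v ∧
      ∀ θ, 0 < θ → D * ((‖v‖ ^ 2 + 1) * θ) ≤ alpha ξ r χ c E t x v ^ 2 / 2 →
      (∫⁻ s in Icc (startTime ξ X t) t, ∫⁻ u : R3,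
          ENNReal.ofReal
            (Real.exp (-∫ τ in s..t, ϖ / 2 * bracket (V τ))
              * (Real.exp (-(Cθ / 2) * ‖V s - u‖ ^ 2) / ‖V s - u‖ ^ (2 - κ))
              * (1 / alpha ξ r χ c E s (X s) u ^ β)))
      ≤ ENNReal.ofReal (C * ((1 + (CE * θ) ^ (-((β - 1) / 2))) * (2 / ϖ)
          + θ ^ ((3 - β) / 2) / (κ₀ * alpha ξ r χ c E t x v) / CE ^ ((β - 1) / 2))) := by
  obtain ⟨C, hC, hvel⟩ := exists_lintegral_velocity_le hb hξ hcollar hε hχ hβ hκ hκ' hCθ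
  set γ := (β - 1) / 2 with hγ
  have hγ0 : 0 < γ := by rw [hγ]; linarith
  have hγ1 : γ < 1 := by rw [hγ]; linarith
  have hγ2 : (3 - β) / 2 = 1 - γ := by rw [hγ]; ring
  have hγ3 : 0 < 1 - γ := by linarith
  refine ⟨C * (1 + 2 / (1 - γ)), by positivity, fun CE M hCE => ?_⟩
  obtain ⟨κ₀, D, hκ₀, hD, hlin⟩ := exists_linear_growth hb hξ hr hε hχ hCE M hT
  refine ⟨κ₀, D, hκ₀, hD, fun E hE ϖ hϖ t ht x hx v X V hX => ?_⟩
  have hα := (alpha_pos_and_one_div_rpow_le hb hξ hcollar hε hχ hCE hE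
    (by linarith : 0 < β) ht hx).1 v
  refine ⟨hα, fun θ hθ hDθ => ?_⟩
  rcases le_or_gt t (startTime ξ X t) with hle | ha
  · have : volume (Icc (startTime ξ X t) t) = 0 := by
      rw [Real.volume_Icc, ENNReal.ofReal_eq_zero]; linarith
    rw [setLIntegral_measure_zero _ _ this]
    exact zero_le
  have h0 := startTime_nonneg ξ X t
  have hlin' := hlin E hE t ht x hx v X V hX ha hα θ hDθ
  set a := startTime ξ X t
  set α := alpha ξ r χ c E t x v
  -- At the initial time the trajectory may lie on the boundary, where the depth vanishes; the open
  -- interval avoids this.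
  rw [setLIntegral_congr Ioo_ae_eq_Icc.symm]
  have hCEγ : 0 < CE ^ (-γ) := by positivity
  calc _ ≤ ∫⁻ s in Ioo a t, ENNReal.ofReal
          (Real.exp (-(ϖ / 2 * (t - s))) * (C + C * CE ^ (-γ) * (-ξ (X s)) ^ (-γ))) := by
        refine setLIntegral_mono' measurableSet_Ioo fun s hs => ?_
        have hXs := mem_dom_of_startTime_lt hs.1 hs.2
        have hXs0 : 0 < -ξ (X s) := neg_pos.2 hXs
        rw [mul_assoc C, ← Real.mul_rpow hCE.le hXs0.le]
        exact hvel T CE M E hCE hE s ⟨h0.trans hs.1.le, hs.2.le.trans ht.2⟩ (X s) hXs (V s) _ _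
          (Real.exp_pos _).le
          (exp_neg_integral_bracket_le hX.continuousOn_vel (Ioo_subset_Icc_self hs) hϖ.le)
    _ ≤ _ := lintegral_exp_mul_rpow_le hγ0 hγ1 (by positivity : 0 < κ₀ * α) hθ
          (by positivity : 0 < ϖ / 2) hC.le (by positivity)
          (fun s hs => neg_pos.2 (mem_dom_of_startTime_lt hs.1 hs.2))
          (fun s hs hle => hlin' s (Ioo_subset_Icc_self hs) (by linarith))
    _ ≤ _ := by
        apply ENNReal.ofReal_le_ofReal
        rw [hγ2, Real.mul_rpow hCE.le hθ.le, inv_div, ← mul_one C]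
        have e1 : θ ^ (1 - γ) / (κ₀ * α) / CE ^ γ
            = CE ^ (-γ) * (θ ^ (1 - γ) / (κ₀ * α)) := by
          rw [Real.rpow_neg hCE.le, inv_mul_eq_div]
        have e2 : θ ^ (1 - γ) / (κ₀ * α * (1 - γ)) = θ ^ (1 - γ) / (κ₀ * α) / (1 - γ) := by
          rw [div_div]
        rw [e1, e2]
        set p := θ ^ (1 - γ) / (κ₀ * α)
        have hp : 0 < p := by positivity
        set q := CE ^ (-γ)
        have hθγ : 0 < θ ^ (-γ) := by positivity
        set w := θ ^ (-γ)
        have a1 : 0 ≤ C * (2 / (1 - γ)) * ((1 + q * w) * (2 / ϖ)) := by positivity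
        have a2 : 0 ≤ C * (q * p) := by positivity
        have a3 : 2 * (C * 1 * q * (p / (1 - γ))) = C * (2 / (1 - γ)) * (q * p) := by ring
        rw [a3]
        nlinarith

end KineticDomain

theorem mainTheorem6 (ξ : R3 → ℝ) (hξ : IsStrictlyConvexDomain ξ) :
    ∃ Cξ : ℝ, 0 < Cξ ∧ ∃ r₀ : ℝ, 0 < r₀ ∧
    ∀ r : ℝ, 0 < r → r < r₀ →
    ∀ (c : ℝ) (χ : ℝ → ℝ), IsCutoff (collarDepth ξ r) c χ →
    ∀ T β κ Cθ : ℝ, 0 < T → 1 < β → β < 3 → 0 < κ → κ ≤ 1 → 0 < Cθ →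
    ∃ C : ℝ, 0 < C ∧
    ∀ CE M : ℝ, 0 < CE →
    ∃ ϖ₀ δ₀ : ℝ, 0 < ϖ₀ ∧ 0 < δ₀ ∧
    ∀ E : ℝ → R3 → R3, IsAdmissibleField ξ T CE M E →
    ∀ ϖ δ : ℝ, ϖ₀ ≤ ϖ → 0 < δ → δ < δ₀ →
    ∀ t ∈ Icc 0 T, ∀ x ∈ dom ξ, ∀ v : R3,
    ∀ X V : ℝ → R3, IsBackwardCharacteristic ξ E t x v X V →
      (∫⁻ s in Icc (startTime ξ X t) t, ∫⁻ u : R3,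
          ENNReal.ofReal
            (Real.exp (-∫ τ in s..t, ϖ / 2 * bracket (V τ))
              * (Real.exp (-(Cθ / 2) * ‖V s - u‖ ^ 2) / ‖V s - u‖ ^ (2 - κ))
              * (1 / alpha ξ r χ c E s (X s) u ^ β)))
      ≤ ENNReal.ofReal
          (C *
            (Real.exp (2 * Cξ * (((gradNorm ξ T E).toReal + (supNorm ξ T E).toReal ^ 2
                    + (supNorm ξ T E).toReal) / CE))
                * (δ ^ ((3 - β) / 2)
                  / (CE ^ ((β - 1) / 2) * alpha ξ r χ c E t x v ^ (β - 2)
                    * (‖v‖ ^ 2 + (supNorm ξ T E).toReal ^ 2 + (supNorm ξ T E).toReal + 1)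
                        ^ ((3 - β) / 2)))
              + (‖v‖ + (supNorm ξ T E).toReal + (supNorm ξ T E).toReal ^ 2 + 1) ^ (β - 1)
                  / (CE ^ (β - 1) * δ ^ (β - 1) * alpha ξ r χ c E t x v ^ (β - 1))
                  * (2 / ϖ))) := by
  -- An empty domain has no boundary points, hence no nearest point and no positive collar depth;
  -- the claim is then vacuous.
  rcases (dom ξ).eq_empty_or_nonempty with hemp | hne
  · refine ⟨1, one_pos, 1, one_pos, fun r _ _ c χ _ T β κ Cθ _ _ _ _ _ _ => ⟨1, one_pos,
      fun CE M _ => ⟨1, 1, one_pos, one_pos, fun E _ ϖ δ _ _ _ t _ x hx => ?_⟩⟩⟩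
    rw [hemp] at hx
    exact hx.elim
  obtain ⟨h, H, L, c₁, ρ, hb⟩ := hξ.exists_domainBounds
  obtain ⟨r₁, hr₁, hdepth⟩ := hξ.exists_collarDepth_pos hne
  obtain ⟨r₂, hr₂, hcol⟩ := hξ.exists_abs_lt hb.ρ_pos
  -- `Cξ = 1` is arbitrary: any positive value makes the exponential at least one. The radius
  -- ensures a positive collar depth and a gradient bounded below in the collar.
  refine ⟨1, one_pos, min r₁ r₂, lt_min hr₁ hr₂, fun r hr hr' c χ hχ T β κ Cθ hT hβ hβ' hκ hκ'
    hCθ => ?_⟩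
  have hε := hdepth r hr (hr'.trans_le (min_le_left _ _))
  have hcollar : ∀ y ∈ collar ξ r, |ξ y| ≤ ρ := fun y hy =>
    (hcol y (subset_closure hy.1) (hy.2.trans (hr'.trans_le (min_le_right _ _)))).le
  have hc := hχ.const_pos hε
  obtain ⟨C, hC, hmain⟩ := exists_lintegral_le hb hξ hcollar hr hε hχ hβ hβ' hκ hκ' hCθ hT
  refine ⟨C * (1 + c ^ (β - 1)), by positivity, fun CE M hCE => ?_⟩
  obtain ⟨κ₀, D, hκ₀, hD, hmain⟩ := hmain CE M hCE
  obtain ⟨δ₀, hδ₀, hthr⟩ := exists_threshold hβ hβ' hCE hκ₀ hD (le_max_right M 0) hc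
  -- Of `ϖ₀` only positivity matters.
  refine ⟨1, δ₀, one_pos, hδ₀, fun E hE ϖ δ hϖ hδ hδ' t ht x hx v X V hX => ?_⟩
  have hϖ0 : 0 < ϖ := one_pos.trans_le hϖ
  obtain ⟨hα, hmain⟩ := hmain E hE ϖ hϖ0 t ht x hx v X V hX
  have hP : 1 ≤ Real.exp (2 * 1 * (((gradNorm ξ T E).toReal + (supNorm ξ T E).toReal ^ 2
      + (supNorm ξ T E).toReal) / CE)) := Real.one_le_exp (by positivity)
  obtain ⟨θ, hθ, hDθ, hle⟩ := hthr δ _ _ ‖v‖ _ ϖ hδ hδ' hα (alpha_le_const hε hχ t x v)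
    ENNReal.toReal_nonneg hE.toReal_supNorm_le (norm_nonneg v) hP hϖ0
  refine (hmain θ hθ hDθ).trans (ENNReal.ofReal_le_ofReal ?_)
  rw [mul_assoc C]
  exact mul_le_mul_of_nonneg_left hle hC.le
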